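/- **Proposition 4.1 (zeros of TM functions).** Let $m\ge 1$ and let $\mathscr A_m$ be the real Clifford algebra generated by $e_1,\dots,e_m$ with $e_ie_j+e_je_i=-2\delta_{ij}$, with conjugation $x\mapsto\overline x$ and Euclidean coefficient norm $|x|$; identify $x\in\mathbb R^{m+1}$ with $x_0+x_1e_1+\dots+x_me_m$. Let $B^{m+1}$ be the open unit ball of $\mathbb R^{m+1}$ and $\mathcal H^2$ the space of left monogenic $f:B^{m+1}\to\mathscr A_m$ with $\|f\|=\sup_{0<r<1}\big(\frac1{\omega_m}\int_{S^m}|f(r\eta)|^2dS\big)^{1/2}<\infty$, where $\omega_m$ is the area of $S^m$, with the inner product $\langle f,g\rangle=\frac1{\omega_m}\int_{S^m}\overline{g}f\,dS$ of non-tangential boundary values. Let $S_a(x)=\overline{1-\overline ax}\,/\,|1-\overline ax|^{m+1}$ be the Szegő kernel. Let $a_1,a_2,\dots\in B^{m+1}$ be parameters, not necessarily distinct, and $\omega_1,\omega_2,\dots\in S^m$ directions (used only for repeated parameters). The Takenaka–Malmquist (TM) system $B_n=B_{a_1,\dots,a_n}$ is defined recursively. For $b\in B^{m+1}$ put $$T_{a_1,\dots,a_{n-1},b}=S_b-\sum_{i=1}^{n-1}P_iS_b,$$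 where $P_i$ is the orthogonal projection onto the right $\mathscr A_m$-module generated by $B_i$. If $a_n\notin\{a_1,\dots,a_{n-1}\}$, then $B_n=T_{a_1,\dots,a_n}/\|T_{a_1,\dots,a_n}\|$; otherwise $$B_n=\lim_{\rho\to0^+}\frac{T_{a_1,\dots,a_{n-1},\,a_n+\rho\omega_n}}{\|T_{a_1,\dots,a_{n-1},\,a_n+\rho\omega_n}\|}\quad\text{in }\mathcal H^2 .$$ Write $m(a_n)=\#\{j\le n:a_j=a_n\}$, and write $\partial_v^k$ for the $k$-th derivative in the direction $v$. Then the TM system exists. For each $j$ there is a least integer $\kappa_j\ge0$ such that the higher order Szegő kernel $K_j=\partial_{\omega_j}^{\kappa_j}S_y|_{y=a_j}$ (derivative in $y$) is not in the right $\mathscr A_m$-span of $B_1,\dots,B_{j-1}$, and $B_j$ is the normalized Gram–Schmidt remainder of $K_j$ with respect to $B_1,\dots,B_{j-1}$. For every $n$ and every $i\le n-1$, the point $a_i$ is a zero of $B_n$ of multiplicity (at least) $m(a_i)$ in the following sense: 1. $B_n(a_i)=0$, and for each of the $m(a_i)$ indices $j\le i$ with $a_j=a_i$, $$\partial_{\omega_j}^{k}B_n(a_i)=0\qquad(0\le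 k\le\kappa_j).$$ 2. If $\omega_j=\omega_i$ for all $j<i$ with $a_j=a_i$, then $\kappa_i=m(a_i)-1$, and hence $\partial_{\omega_i}^kB_n(a_i)=0$ for $0\le k<m(a_i)$, so $t\mapsto B_n(a_i+t\omega_i)$ has at $t=0$ a zero of order at least $m(a_i)$. The equality $\kappa_j=m(a_j)-1$ in (2) holds for every index $j$ with $\omega_i=\omega_j$ whenever $i<j$ and $a_i=a_j$. Moreover, for every $n$, $\partial_{\omega_n}^kB_n(a_n)=0$ for $0\le k<\kappa_n$ and $\partial_{\omega_n}^{\kappa_n}B_n(a_n)\ne0$. -/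

import Mathlib

open MeasureTheory Filter Topology
open scoped symmDiff

noncomputable section

namespace CliffordTM

/-! ## The real Clifford algebra `𝒜_m` -/

/-- The real Clifford algebra with generators `e_1, …, e_m`, as the space of coefficient families
`(x_T)` with `T ⊆ {1, …, m}` (here `Fin m`). Its norm is `|x| = (∑ x_T ^ 2) ^ (1/2)`. -/
def Cl (m : ℕ) : Type := EuclideanSpace ℝ (Finset (Fin m))

instance (m : ℕ) : NormedAddCommGroup (Cl m) :=
  inferInstanceAs (NormedAddCommGroup (EuclideanSpace ℝ (Finset (Fin m))))

instance (m : ℕ) : InnerProductSpace ℝ (Cl m) :=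
  inferInstanceAs (InnerProductSpace ℝ (EuclideanSpace ℝ (Finset (Fin m))))

variable {m : ℕ}

/-- The coefficient `x_T` of `x`. -/
def Cl.coeff (x : Cl m) (T : Finset (Fin m)) : ℝ := WithLp.ofLp x T

/-- The Clifford number with coefficients `c`. -/
def Cl.mk (c : Finset (Fin m) → ℝ) : Cl m := WithLp.toLp 2 c

/-- The basic element `e_T`. -/
def Cl.e (T : Finset (Fin m)) : Cl m := Cl.mk (fun U => if U = T then 1 else 0)

/-- The sign in `e_A e_B = (-1)^{#(A ∩ B)} (-1)^{p(A,B)} e_{A ∆ B}`, where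
`p(A,B) = ∑_{j ∈ B} #{i ∈ A : i > j}`. -/
def mulSign (A B : Finset (Fin m)) : ℤ :=
  (-1) ^ (A ∩ B).card * (-1) ^ (∑ j ∈ B, (A.filter (fun i => j < i)).card)

instance : One (Cl m) := ⟨Cl.e ∅⟩

/-- The bilinear extension of the multiplication of basic elements. -/
instance : Mul (Cl m) :=
  ⟨fun x y => ∑ A : Finset (Fin m), ∑ B : Finset (Fin m),
    ((mulSign A B : ℝ) * x.coeff A * y.coeff B) • Cl.e (A ∆ B)⟩

/-- Clifford conjugation: the linear map with
`e_T ↦ (-e_{i_l}) ⋯ (-e_{i_1}) = (-1)^{l(l+1)/2} e_T` for `T = {i_1 < ⋯ < i_l}`. -/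
def Cl.conj (x : Cl m) : Cl m :=
  Cl.mk (fun T => (-1) ^ (T.card * (T.card + 1) / 2) * x.coeff T)

/-! ## Monogenic functions on the unit ball -/

/-- The Euclidean space `ℝ^{m+1}`, with coordinates `x_0, …, x_m`. -/
abbrev E (m : ℕ) : Type := EuclideanSpace ℝ (Fin (m + 1))

/-- The vectors `e_0 = 1, e_1, …, e_m` of the Clifford algebra. -/
def eVec (i : Fin (m + 1)) : Cl m := Fin.cases 1 (fun j => Cl.e {j}) i

/-- The embedding `x ↦ ∑ x_i e_i` of `ℝ^{m+1}` in the Clifford algebra. -/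
def vec (x : E m) : Cl m := ∑ i : Fin (m + 1), x i • eVec i

/-- The open unit ball of `ℝ^{m+1}`. -/
abbrev B1 (m : ℕ) : Set (E m) := Metric.ball 0 1

/-- `f` is left monogenic on the unit ball: it is `C^1` and `∑ e_i ∂f/∂x_i = 0`. -/
def LeftMonogenic (f : E m → Cl m) : Prop :=
  ContDiffOn ℝ 1 f (B1 m) ∧
    ∀ x ∈ B1 m, ∑ i : Fin (m + 1), eVec i * fderiv ℝ f x (EuclideanSpace.single i 1) = 0

/-! ## The monogenic Hardy space -/

/-- The surface measure of the unit sphere of `ℝ^{m+1}`; its total mass is the area `ω_m`. -/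
def surf (m : ℕ) : Measure (Metric.sphere (0 : E m) 1) := (volume : Measure (E m)).toSphere

/-- The mean `((1/ω_m) ∫ |f(rη)|^2 dS)^{1/2}` over the unit sphere. -/
def sphereMean (f : E m → Cl m) (r : ℝ) : ℝ :=
  Real.sqrt (⨍ η, ‖f (r • (η : E m))‖ ^ 2 ∂(surf m))

/-- The Hardy space of the unit ball. -/
def MemHardy (f : E m → Cl m) : Prop :=
  LeftMonogenic f ∧ BddAbove (sphereMean f '' Set.Ioo 0 1)

/-- The Hardy norm `sup_{0<r<1} ((1/ω_m) ∫ |f(rη)|^2 dS)^{1/2}`. -/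
def hardyNorm (f : E m → Cl m) : ℝ := sSup (sphereMean f '' Set.Ioo 0 1)

/-- Non-tangential approach to `η` from inside the ball: a function tends to a limit along this
filter iff it does so within each of the regions `|x - η| < α (1 - |x|)`. -/
def nontangential (η : E m) : Filter (E m) :=
  ⨆ α : ℝ, 𝓝[{x : E m | ‖x‖ < 1 ∧ ‖x - η‖ < α * (1 - ‖x‖)}] η

/-- The non-tangential boundary limit of `f` at `η`. -/
def boundary (f : E m → Cl m) (η : E m) : Cl m :=
  @limUnder _ _ _ ⟨(0 : Cl m)⟩ (nontangential η) f

/-- The Clifford-valued inner product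
`⟨f, g⟩ = (1/ω_m) ∫ conj (g η) (f η) dS` of the boundary limits. -/
def hardyInner (f g : E m → Cl m) : Cl m :=
  ⨍ η, (boundary g (η : E m)).conj * boundary f (η : E m) ∂(surf m)

/-! ## Szegő kernels and their derivatives -/

/-- The Szegő kernel `S_a(x) = conj (1 - conj a x) / |1 - conj a x|^{m+1}` of the ball. -/
def szego (a x : E m) : Cl m :=
  (‖(1 : Cl m) - (vec a).conj * vec x‖ ^ (m + 1))⁻¹ • ((1 : Cl m) - (vec a).conj * vec x).conj

/-- The `k`-th derivative `∂_v^k f (c)` of `f` at `c` in the direction `v`. -/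
def dirDeriv (k : ℕ) (v : E m) (f : E m → Cl m) (c : E m) : Cl m :=
  iteratedDeriv k (fun t : ℝ => f (c + t • v)) 0

/-- The higher order Szegő kernel: the function `x ↦ ∂_v^k S_y(x)` at `y = a`, the derivative being
taken in the parameter `y`. -/
def szegoDeriv (k : ℕ) (v a : E m) : E m → Cl m :=
  fun x => dirDeriv k v (fun y => szego y x) a

/-! ## Gram–Schmidt orthogonalization and the Takenaka–Malmquist system -/

open Classical in
/-- The orthogonal projection of `α` onto the right module spanned by `β`: the function `β c` with
`⟨α - β c, β⟩ = 0`. If `⟨β, β⟩` is invertible, then `c = ⟨β, β⟩⁻¹ ⟨α, β⟩`. -/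
def proj (β α : E m → Cl m) : E m → Cl m :=
  if h : ∃ c : Cl m, hardyInner (fun x => α x - β x * c) β = 0 then
    fun x => β x * h.choose
  else 0

/-- The Gram–Schmidt remainder of `α` after `B_0, …, B_{n-1}`. -/
def remainder (B : ℕ → E m → Cl m) (n : ℕ) (α : E m → Cl m) : E m → Cl m :=
  fun x => α x - ∑ i ∈ Finset.range n, proj (B i) α x

/-- `f / ‖f‖`. -/
def normalize (f : E m → Cl m) : E m → Cl m := fun x => (hardyNorm f)⁻¹ • f x

/-- `B_0, B_1, …` is the Takenaka–Malmquist system with parameters `a_0, a_1, …`. A parameter `a_n`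
that differs from all earlier ones contributes the normalized Gram–Schmidt remainder of `S_{a_n}`;
a repeated parameter contributes the limit in the Hardy space, as `ρ → 0+`, of the function that
belongs to the parameter `a_n + ρ ω_n` in place of `a_n`. -/
structure IsTMSystem (a ω : ℕ → E m) (B : ℕ → E m → Cl m) : Prop where
  memHardy : ∀ n, MemHardy (B n)
  fresh : ∀ n, (∀ j < n, a j ≠ a n) →
    Set.EqOn (B n) (normalize (remainder B n (szego (a n)))) (B1 m)
  repeated : ∀ n, (∃ j < n, a j = a n) →
    Tendsto (fun ρ : ℝ =>
        hardyNorm (fun x => normalize (remainder B n (szego (a n + ρ • ω n))) x - B n x))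
      (𝓝[>] 0) (𝓝 0)

/-- The multiplicity `#{j ≤ n : a_j = a_n}` of the parameter `a_n`. -/
def mult (a : ℕ → E m) (n : ℕ) : ℕ := {j : ℕ | j ≤ n ∧ a j = a n}.ncard

/-- On the ball, `f` is a right linear combination of `B_0, …, B_{n-1}`. -/
def InSpan (B : ℕ → E m → Cl m) (n : ℕ) (f : E m → Cl m) : Prop :=
  ∃ c : ℕ → Cl m, ∀ x ∈ B1 m, f x = ∑ i ∈ Finset.range n, B i x * c i

/-- `f` vanishes at `c` to order at least `M` along the line with direction `v`. -/
def VanishesAlong (f : E m → Cl m) (c v : E m) (M : ℕ) : Prop :=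
  ∀ k < M, dirDeriv k v f c = 0

end CliffordTM

end

/-!
The functions that occur in the recursion all extend continuously to the closed ball, so the
argument takes place in the Banach space `X m` of continuous Clifford-valued functions on the
closed unit ball, with the Clifford-valued inner product `ip` of the restrictions to the sphere.

* *Reproducing property.* A function that is monogenic on a neighbourhood of the closed ball
  satisfies `f a = ⟨f, S_a⟩`. This is Cauchy's formula on the unit sphere (`cauchy_formula`), since
  on the sphere the Cauchy kernel times the normal is the conjugate of the Szegő kernel. Cauchy's
  formula is derived from the divergence theorem in the weak form `∫ ∂F = 0` for compactly
  supported `F`: the form is multiplied by radial cutoffs around the pole and along the boundary,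
  and each cutoff turns into a flux through a sphere as it becomes steep. The subspace `X0 m`
  consists of the functions with the reproducing property, and `⟨·, ·⟩` is definite on it.
* *Derivative kernels.* The map `y ↦ S_y` from the open ball to `X m` is smooth, because pointwise
  square root is a smooth map of positive continuous functions (a local inverse of squaring in a
  Banach algebra). Hence directional derivatives of `f` in `X0 m` at `a` are inner products with
  the derivatives of the kernel in its parameter (`dirDeriv_eq_ip`).
* *Gram–Schmidt.* The functions of the system need not have scalar `⟨B, B⟩`, so that one projects
  onto finitely generated right modules rather than subtracting `B⟨f, B⟩`. Such a module is a
  finite-dimensional real subspace on which the real part of `⟨·, ·⟩` is definite; its real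
  orthogonal projection is also orthogonal for the Clifford-valued product, because the module is
  stable under right multiplication. For an orthogonal system the successive projections of the
  recursion add up to it (`rep_remainder`).
* *The limit.* Let `κ` be the least order for which the derivative kernel at `a_n` in the direction
  `ω_n` is outside the span of the earlier functions. The remainder of `S_{a_n + ρ ω_n}` is a
  smooth function of `ρ` whose derivatives of order less than `κ` vanish at `0`. After
  normalization it therefore converges, as `ρ → 0+`, to the normalized remainder of the derivative
  kernel of order `κ`.
* *The orders.* That `κ` exists, is `0` at a new parameter and counts the earlier occurrences of a
  parameter with constant direction, all follows from `Adapted.szegoDerivX_notMem`: a monogenic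
  function separates a derivative kernel at `a_n` from the earlier ones. In the plane of `ω_n` and
  a unit vector `u ⊥ ω_n`, the element `ω̄_n u` squares to `-1`, and with it as the imaginary unit
  polynomials in the complex coordinate of this plane are monogenic (`planeWave_monogenic`). For
  generic `u` the points `p ≠ a_n` have coordinates different from that of `a_n`, and
  `(z - z_a)^M ∏ (z - z_p)^(N + 1)` has the required zeros and the required nonzero derivative.

The zeros of `B_n` are then its orthogonality to the earlier derivative kernels, which lie in the
span of the earlier functions, and the last derivative at `a_n` is a nonzero real multiple of
`⟨B_n, B_n⟩ ≠ 0`.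
-/

namespace CliffordTM

noncomputable section

variable {m : ℕ}

open scoped RealInnerProductSpace

/-! ### The Clifford algebra as an associative algebra -/

/-- The sign is bimultiplicative: `i ∈ A` and `j ∈ B` contribute `-1` if `j ≤ i`. -/
lemma mulSign_eq_prod (A B : Finset (Fin m)) :
    mulSign A B = ∏ i ∈ A, ∏ j ∈ B, (if j ≤ i then -1 else 1 : ℤ) := by
  have h : ∀ j : Fin m, ∏ i ∈ A, (if j ≤ i then -1 else 1 : ℤ)
      = (if j ∈ A then -1 else 1) * (-1) ^ (A.filter (fun i => j < i)).card := by
    intro j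
    have h1 : ∀ i, (if j ≤ i then -1 else 1 : ℤ)
        = (if j = i then -1 else 1) * (if j < i then -1 else 1) := by
      intro i
      rcases lt_trichotomy j i with h | h | h
      · simp [h.le, h, h.ne]
      · simp [h]
      · simp [h.not_ge, h.ne', h.not_gt]
    simp_rw [h1]
    rw [Finset.prod_mul_distrib, Finset.prod_ite_eq, Finset.prod_ite, Finset.prod_const]
    simp
  rw [Finset.prod_comm]
  simp_rw [h]
  rw [Finset.prod_mul_distrib, Finset.prod_pow_eq_pow_sum, mulSign, ← Finset.prod_filter,
    Finset.prod_const]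
  congr 3
  ext j
  simp [and_comm]

lemma prod_symmDiff {ι : Type*} [DecidableEq ι] (A B : Finset ι) (f : ι → ℤ)
    (hf : ∀ i, f i * f i = 1) : ∏ i ∈ A ∆ B, f i = (∏ i ∈ A, f i) * ∏ i ∈ B, f i := by
  have h1 : ∏ i ∈ A, f i = (∏ i ∈ A \ B, f i) * ∏ i ∈ A ∩ B, f i := by
    rw [← Finset.prod_union (Finset.disjoint_sdiff_inter A B), Finset.sdiff_union_inter]
  have h2 : ∏ i ∈ B, f i = (∏ i ∈ B \ A, f i) * ∏ i ∈ A ∩ B, f i := by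
    rw [Finset.inter_comm, ← Finset.prod_union (Finset.disjoint_sdiff_inter B A),
      Finset.sdiff_union_inter]
  have h3 : (∏ i ∈ A ∩ B, f i) * ∏ i ∈ A ∩ B, f i = 1 := by
    rw [← Finset.prod_mul_distrib]; simp [hf]
  rw [h1, h2, symmDiff_def, Finset.sup_eq_union, Finset.prod_union disjoint_sdiff_sdiff]
  linear_combination (-(∏ i ∈ A \ B, f i) * ∏ i ∈ B \ A, f i) * h3

lemma mulSign_symmDiff_left (A B C : Finset (Fin m)) :
    mulSign (A ∆ B) C = mulSign A C * mulSign B C := by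
  simp only [mulSign_eq_prod]
  refine prod_symmDiff _ _ _ fun i => ?_
  rw [← Finset.prod_mul_distrib]
  refine Finset.prod_eq_one fun j _ => ?_
  split_ifs <;> simp

lemma mulSign_symmDiff_right (A B C : Finset (Fin m)) :
    mulSign A (B ∆ C) = mulSign A B * mulSign A C := by
  simp only [mulSign_eq_prod]
  rw [← Finset.prod_mul_distrib]
  refine Finset.prod_congr rfl fun i _ => ?_
  refine prod_symmDiff _ _ _ fun j => ?_
  split_ifs <;> simp

lemma mulSign_mul_self (A B : Finset (Fin m)) : mulSign A B * mulSign A B = 1 := by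
  rw [mulSign]
  rw [mul_mul_mul_comm, ← mul_pow, ← mul_pow]; simp

@[simp] lemma mulSign_empty_left (A : Finset (Fin m)) : mulSign ∅ A = 1 := by simp [mulSign]
@[simp] lemma mulSign_empty_right (A : Finset (Fin m)) : mulSign A ∅ = 1 := by simp [mulSign]

lemma card_filter_lt_sum (T : Finset (Fin m)) :
    T.card + ∑ j ∈ T, (T.filter (fun i => j < i)).card = T.card * (T.card + 1) / 2 := by
  induction T using Finset.induction_on_min with
  | empty => simp
  | insert a s h ih =>
    have ha : a ∉ s := fun h' => lt_irrefl _ (h a h')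
    rw [Finset.sum_insert ha, Finset.card_insert_of_notMem ha]
    have h1 : ((insert a s).filter (fun i => a < i)) = s := by
      ext i
      simp only [Finset.mem_filter, Finset.mem_insert]
      constructor
      · rintro ⟨rfl | h1, h2⟩
        · exact absurd h2 (lt_irrefl _)
        · exact h1
      · intro h'; exact ⟨Or.inr h', h i h'⟩
    have h2 : ∀ j ∈ s, ((insert a s).filter (fun i => j < i)).card
        = (s.filter (fun i => j < i)).card := by
      intro j hj
      congr 1
      rw [Finset.filter_insert, if_neg (h j hj).not_gt]
    rw [h1, Finset.sum_congr rfl h2]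
    have h3 : (s.card + 1) * (s.card + 1 + 1) / 2 = s.card * (s.card + 1) / 2 + (s.card + 1) := by
      rw [show (s.card + 1) * (s.card + 1 + 1) = s.card * (s.card + 1) + (s.card + 1) * 2 by ring]
      exact Nat.add_mul_div_right _ _ (by norm_num)
    rw [h3, ← ih]; ring

/-- The sign of `e_T` under conjugation is the sign of `e_T * e_T`. -/
lemma conj_sign_eq (T : Finset (Fin m)) :
    (-1 : ℝ) ^ (T.card * (T.card + 1) / 2) = (mulSign T T : ℝ) := by
  rw [← card_filter_lt_sum, mulSign, pow_add]
  simp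

namespace Cl

@[ext] lemma ext_coeff {x y : Cl m} (h : ∀ T, x.coeff T = y.coeff T) : x = y :=
  PiLp.ext h

@[simp] lemma coeff_mk (c : Finset (Fin m) → ℝ) (T) : (Cl.mk c).coeff T = c T := rfl
@[simp] lemma coeff_add (x y : Cl m) (T) : (x + y).coeff T = x.coeff T + y.coeff T := rfl
@[simp] lemma coeff_zero (T) : (0 : Cl m).coeff T = 0 := rfl
@[simp] lemma coeff_smul (r : ℝ) (x : Cl m) (T) : (r • x).coeff T = r * x.coeff T := rfl
lemma coeff_e (T U : Finset (Fin m)) : (Cl.e T).coeff U = if U = T then 1 else 0 := rfl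

/-- The coefficient `x ↦ x_T` as a linear form. -/
def coeffₗ (T : Finset (Fin m)) : Cl m →ₗ[ℝ] ℝ where
  toFun x := x.coeff T
  map_add' _ _ := rfl
  map_smul' _ _ := rfl

@[simp] lemma coeff_sum {ι : Type*} (s : Finset ι) (f : ι → Cl m) (T) :
    (∑ i ∈ s, f i).coeff T = ∑ i ∈ s, (f i).coeff T := map_sum (coeffₗ T) f s

lemma mul_def (x y : Cl m) : x * y = ∑ A : Finset (Fin m), ∑ B : Finset (Fin m),
    ((mulSign A B : ℝ) * x.coeff A * y.coeff B) • Cl.e (A ∆ B) := rfl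

lemma coeff_mul (x y : Cl m) (T : Finset (Fin m)) :
    (x * y).coeff T = ∑ A, (mulSign A (A ∆ T) : ℝ) * x.coeff A * y.coeff (A ∆ T) := by
  rw [mul_def, coeff_sum]
  refine Finset.sum_congr rfl fun A _ => ?_
  rw [coeff_sum, Finset.sum_eq_single (A ∆ T)]
  · simp [coeff_e]
  · intro B _ hB
    rw [coeff_smul, coeff_e, if_neg, mul_zero]
    rintro rfl
    simp at hB
  · simp

lemma one_def : (1 : Cl m) = Cl.e ∅ := rfl

lemma add_mul' (x y z : Cl m) : (x + y) * z = x * z + y * z := by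
  ext T; simp only [coeff_mul, coeff_add, ← Finset.sum_add_distrib]
  exact Finset.sum_congr rfl fun A _ => by ring

lemma mul_add' (x y z : Cl m) : x * (y + z) = x * y + x * z := by
  ext T; simp only [coeff_mul, coeff_add, ← Finset.sum_add_distrib]
  exact Finset.sum_congr rfl fun A _ => by ring

lemma smul_mul' (r : ℝ) (x y : Cl m) : (r • x) * y = r • (x * y) := by
  ext T; simp only [coeff_mul, coeff_smul, Finset.mul_sum]
  exact Finset.sum_congr rfl fun A _ => by ring

lemma mul_smul' (r : ℝ) (x y : Cl m) : x * (r • y) = r • (x * y) := by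
  ext T; simp only [coeff_mul, coeff_smul, Finset.mul_sum]
  exact Finset.sum_congr rfl fun A _ => by ring

lemma mul_assoc' (x y z : Cl m) : x * y * z = x * (y * z) := by
  ext T
  simp only [coeff_mul, Finset.mul_sum, Finset.sum_mul]
  rw [Finset.sum_comm]
  refine Finset.sum_congr rfl fun A _ => ?_
  refine Fintype.sum_equiv (symmDiff_right_involutive A).toPerm _ _ fun B => ?_
  have e1 : (A ∆ B) ∆ (A ∆ T) = B ∆ T := by
    rw [symmDiff_comm A B, symmDiff_assoc, symmDiff_symmDiff_cancel_left]
  have h2 : (mulSign A T : ℝ) * mulSign A T = 1 := by exact_mod_cast mulSign_mul_self A T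
  simp only [Function.Involutive.coe_toPerm, e1]
  simp only [mulSign_symmDiff_left, mulSign_symmDiff_right]
  push_cast
  linear_combination (-(mulSign A A : ℝ) * mulSign A B * mulSign B B * mulSign B T
    * x.coeff A * y.coeff (A ∆ B) * z.coeff (B ∆ T)) * h2

lemma one_mul' (x : Cl m) : 1 * x = x := by
  ext T
  rw [coeff_mul, Finset.sum_eq_single ∅]
  · have h : (∅ : Finset (Fin m)) ∆ T = T := bot_symmDiff T
    simp [one_def, coeff_e, h]
  · intro B _ hB; simp [one_def, coeff_e, hB]
  · simp

lemma mul_one' (x : Cl m) : x * 1 = x := by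
  ext T
  rw [coeff_mul, Finset.sum_eq_single T]
  · simp [one_def, coeff_e]
  · intro B _ hB
    have : B ∆ T ≠ ∅ := fun h => hB (symmDiff_eq_bot.mp h)
    simp [one_def, coeff_e, this]
  · simp

end Cl

/-- The Clifford algebra is a ring. The instance is scoped, so that outside the namespace the
zero of `Cl m` is found in its normed group structure. -/
scoped instance : Ring (Cl m) where
  __ := (inferInstance : AddCommGroup (Cl m))
  mul := (· * ·)
  one := 1
  mul_assoc := Cl.mul_assoc'
  one_mul := Cl.one_mul'
  mul_one := Cl.mul_one'
  left_distrib := Cl.mul_add'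
  right_distrib := Cl.add_mul'
  zero_mul x := by ext T; simp [Cl.coeff_mul]
  mul_zero x := by ext T; simp [Cl.coeff_mul]

scoped instance : Algebra ℝ (Cl m) := Algebra.ofModule Cl.smul_mul' Cl.mul_smul'

/-! ### Product and conjugation as continuous maps -/

namespace Cl

instance : FiniteDimensional ℝ (Cl m) :=
  inferInstanceAs (FiniteDimensional ℝ (EuclideanSpace ℝ (Finset (Fin m))))

instance : CompleteSpace (Cl m) := FiniteDimensional.complete ℝ (Cl m)

/-- The Clifford product as a continuous bilinear map. -/
def mulL : Cl m →L[ℝ] Cl m →L[ℝ] Cl m :=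
  LinearMap.toContinuousLinearMap
    ((LinearMap.toContinuousLinearMap (𝕜 := ℝ) (E := Cl m) (F' := Cl m)).toLinearMap ∘ₗ
      LinearMap.mul ℝ (Cl m))

@[simp] lemma mulL_apply (x y : Cl m) : mulL x y = x * y := rfl

instance : IsTopologicalRing (Cl m) where
  continuous_mul := by
    simpa using (mulL (m := m)).isBoundedBilinearMap.continuous

instance : Nontrivial (Cl m) := ⟨⟨1, 0, fun h => by
  have := congrArg (fun x => Cl.coeff x ∅) h
  simp [one_def, coeff_e] at this⟩⟩

/-- Clifford conjugation as a continuous linear map. -/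
def conjL : Cl m →L[ℝ] Cl m := LinearMap.toContinuousLinearMap
  { toFun := Cl.conj
    map_add' := fun x y => by ext T; simp [Cl.conj, mul_add]
    map_smul' := fun r x => by ext T; simp [Cl.conj]; ring }

@[simp] lemma conjL_apply (x : Cl m) : conjL x = x.conj := rfl

lemma conj_add (x y : Cl m) : (x + y).conj = x.conj + y.conj := map_add conjL x y
lemma conj_sub (x y : Cl m) : (x - y).conj = x.conj - y.conj := map_sub conjL x y
lemma conj_smul (r : ℝ) (x : Cl m) : (r • x).conj = r • x.conj := map_smul conjL r x
lemma conj_sum {ι : Type*} (s : Finset ι) (f : ι → Cl m) :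
    (∑ i ∈ s, f i).conj = ∑ i ∈ s, (f i).conj := map_sum conjL f s
@[simp] lemma conj_zero : (0 : Cl m).conj = 0 := map_zero conjL

lemma coeff_conj (x : Cl m) (T) : x.conj.coeff T = (mulSign T T : ℝ) * x.coeff T := by
  rw [← conj_sign_eq]; rfl

@[simp] lemma conj_conj (x : Cl m) : x.conj.conj = x := by
  ext T
  have h2 : (mulSign T T : ℝ) * mulSign T T = 1 := by exact_mod_cast mulSign_mul_self T T
  rw [coeff_conj, coeff_conj, ← mul_assoc, h2, one_mul]

lemma conj_e (T : Finset (Fin m)) : (Cl.e T).conj = (mulSign T T : ℝ) • Cl.e T := by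
  ext U
  rw [coeff_conj, coeff_smul, coeff_e]
  split_ifs with h
  · rw [h]
  · simp

@[simp] lemma conj_one : (1 : Cl m).conj = 1 := by rw [one_def, conj_e]; simp

lemma conj_mul (x y : Cl m) : (x * y).conj = y.conj * x.conj := by
  rw [mul_def, mul_def, conj_sum, Finset.sum_comm]
  simp_rw [conj_sum]
  refine Finset.sum_congr rfl fun B _ => Finset.sum_congr rfl fun A _ => ?_
  rw [conj_smul, conj_e, smul_smul, symmDiff_comm A B, coeff_conj, coeff_conj]
  congr 1
  simp only [mulSign_symmDiff_left, mulSign_symmDiff_right]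
  push_cast
  have h2 : (mulSign B A : ℝ) * mulSign B A = 1 := by exact_mod_cast mulSign_mul_self B A
  linear_combination x.coeff B * y.coeff A * mulSign B B * mulSign A A * mulSign A B * h2

lemma inner_eq_sum (x y : Cl m) : ⟪x, y⟫ = ∑ T, x.coeff T * y.coeff T := by
  have : ⟪x, y⟫ = ∑ T, ⟪x.coeff T, y.coeff T⟫ :=
    PiLp.inner_apply (𝕜 := ℝ) (f := fun _ : Finset (Fin m) => ℝ) x y
  rw [this]
  exact Finset.sum_congr rfl fun T _ => by simp [mul_comm]

lemma coeff_empty_conj_mul (x y : Cl m) : (x.conj * y).coeff ∅ = ⟪x, y⟫ := by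
  rw [coeff_mul, inner_eq_sum]
  refine Finset.sum_congr rfl fun T _ => ?_
  have h2 : (mulSign T T : ℝ) * mulSign T T = 1 := by exact_mod_cast mulSign_mul_self T T
  have h3 : T ∆ ∅ = T := symmDiff_bot T
  rw [h3, coeff_conj]
  linear_combination x.coeff T * y.coeff T * h2

/-- The scalar part as a continuous linear form. -/
def re : Cl m →L[ℝ] ℝ := LinearMap.toContinuousLinearMap (coeffₗ ∅)

lemma re_apply (x : Cl m) : re x = x.coeff ∅ := rfl
lemma re_conj_mul (x y : Cl m) : re (x.conj * y) = ⟪x, y⟫ := coeff_empty_conj_mul x y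
@[simp] lemma re_one : re (1 : Cl m) = 1 := by simp [re_apply, one_def, coeff_e]

lemma eq_zero_of_re_conj_mul {x : Cl m} (h : ∀ c : Cl m, re (c.conj * x) = 0) : x = 0 := by
  have := h x
  rwa [re_conj_mul, inner_self_eq_zero] at this

lemma norm_sq_smul_one {x : Cl m} {r : ℝ} (h : x.conj * x = r • (1 : Cl m)) : ‖x‖ ^ 2 = r := by
  rw [← real_inner_self_eq_norm_sq, ← re_conj_mul, h]; simp

lemma e_mul_e (A B : Finset (Fin m)) : Cl.e A * Cl.e B = (mulSign A B : ℝ) • Cl.e (A ∆ B) := by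
  rw [mul_def, Finset.sum_eq_single A, Finset.sum_eq_single B]
  · simp [coeff_e]
  · intro C _ hC; simp [coeff_e, hC]
  · simp
  · intro C _ hC; simp [coeff_e, hC]
  · simp

end Cl

/-! ### Paravectors -/

/-- The embedding `vec` as a continuous linear map. -/
def vecL : E m →L[ℝ] Cl m := LinearMap.toContinuousLinearMap
  { toFun := vec
    map_add' := fun x y => by simp [vec, add_smul, Finset.sum_add_distrib]
    map_smul' := fun r x => by simp [vec, mul_smul, Finset.smul_sum] }

@[simp] lemma vecL_apply (x : E m) : vecL x = vec x := rfl
lemma vec_add (x y : E m) : vec (x + y) = vec x + vec y := map_add vecL x y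
lemma vec_sub (x y : E m) : vec (x - y) = vec x - vec y := map_sub vecL x y
lemma vec_smul (r : ℝ) (x : E m) : vec (r • x) = r • vec x := map_smul vecL r x

lemma vec_single (i : Fin (m + 1)) : vec (EuclideanSpace.single i (1 : ℝ)) = eVec i := by
  rw [vec, Finset.sum_eq_single i] <;> simp +contextual

/-- The Clifford relations in the form `ē_i e_j + ē_j e_i = 2 δ_ij`. -/
lemma conj_eVec_mul (i j : Fin (m + 1)) :
    (eVec i).conj * eVec j + (eVec j).conj * eVec i
      = (if i = j then (2 : ℝ) else 0) • (1 : Cl m) := by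
  refine Fin.cases ?_ (fun i => ?_) i <;> refine Fin.cases ?_ (fun j => ?_) j
  · simp [eVec, two_smul]
  · have : (0 : Fin (m + 1)) ≠ j.succ := (Fin.succ_ne_zero j).symm
    simp [eVec, Cl.conj_e, mulSign, this, Finset.filter_singleton]
  · simp [eVec, Cl.conj_e, mulSign, Finset.filter_singleton]
  · simp only [eVec, Fin.cases_succ, Cl.conj_e, Cl.e_mul_e, Cl.smul_mul', smul_smul, Fin.succ_inj]
    rcases lt_trichotomy i j with h | h | h
    · have h1 : ({j} : Finset (Fin m)) ∆ {i} = {i} ∆ {j} := symmDiff_comm _ _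
      simp [h1, mulSign, Finset.filter_singleton, h, h.ne, h.not_gt, h.ne']
    · simp [h, ← Cl.one_def, mulSign, Finset.filter_singleton, two_smul]
    · have h1 : ({j} : Finset (Fin m)) ∆ {i} = {i} ∆ {j} := symmDiff_comm _ _
      simp [h1, mulSign, Finset.filter_singleton, h, h.ne, h.not_gt, h.ne']

lemma eVec_add_conj (i : Fin (m + 1)) :
    eVec i + (eVec i).conj = (if i = 0 then (2 : ℝ) else 0) • (1 : Cl m) := by
  simpa [eVec, add_comm, eq_comm] using conj_eVec_mul (m := m) 0 i

lemma conj_vec_mul_add (x y : E m) :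
    (vec x).conj * vec y + (vec y).conj * vec x = (2 * ⟪x, y⟫) • (1 : Cl m) := by
  have h : ∀ x y : E m, (vec x).conj * vec y
      = ∑ i, ∑ j, (x i * y j) • ((eVec i).conj * eVec j) := by
    intro x y
    simp only [vec, Cl.conj_sum, Finset.sum_mul_sum, Cl.conj_smul, smul_mul_assoc,
      mul_smul_comm, smul_smul]
    exact Finset.sum_congr rfl fun i _ => Finset.sum_congr rfl fun j _ => by rw [mul_comm]
  rw [h x y, h y x, Finset.sum_comm (f := fun i j => (y i * x j) • ((eVec i).conj * eVec j)),
    ← Finset.sum_add_distrib]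
  have : ∀ i, ∑ j, (x i * y j) • ((eVec i).conj * eVec j)
        + ∑ j, (y j * x i) • ((eVec j).conj * eVec i) = (2 * (x i * y i)) • (1 : Cl m) := by
    intro i
    rw [← Finset.sum_add_distrib, Finset.sum_eq_single i]
    · rw [mul_comm (y i), ← smul_add, conj_eVec_mul, smul_smul]; simp [mul_comm]
    · intro j _ hj
      rw [mul_comm (y j), ← smul_add, conj_eVec_mul, if_neg hj.symm]; simp
    · simp
  simp_rw [this]
  rw [← Finset.sum_smul, ← Finset.mul_sum, PiLp.inner_apply]
  simp [mul_comm]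

lemma conj_vec_mul_self (x : E m) : (vec x).conj * vec x = (‖x‖ ^ 2) • (1 : Cl m) := by
  have h := conj_vec_mul_add x x
  rw [← two_smul ℝ, mul_smul, real_inner_self_eq_norm_sq] at h
  exact smul_right_injective _ (two_ne_zero (α := ℝ)) h

/-- The conjugate of a paravector is `2 x_0` minus the paravector. -/
lemma conj_vec (x : E m) : (vec x).conj = (2 * x 0) • (1 : Cl m) - vec x := by
  rw [eq_sub_iff_add_eq']
  simp only [vec, Cl.conj_sum, Cl.conj_smul, ← Finset.sum_add_distrib, ← smul_add, eVec_add_conj]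
  rw [Finset.sum_eq_single 0]
  · simp [smul_smul, mul_comm]
  · intro i _ hi; simp [hi]
  · simp

lemma vec_mul_conj_self (x : E m) : vec x * (vec x).conj = (‖x‖ ^ 2) • (1 : Cl m) := by
  rw [← conj_vec_mul_self, conj_vec, mul_sub, sub_mul]
  simp

lemma vec_mul_conj_add (x y : E m) :
    vec x * (vec y).conj + vec y * (vec x).conj = (2 * ⟪x, y⟫) • (1 : Cl m) := by
  have h := vec_mul_conj_self (x + y)
  rw [vec_add, Cl.conj_add, mul_add, add_mul, add_mul, vec_mul_conj_self, vec_mul_conj_self,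
    norm_add_sq_real, add_smul, add_smul] at h
  have : vec x * (vec y).conj + vec y * (vec x).conj = (‖x‖ ^ 2) • (1 : Cl m)
    + vec y * (vec x).conj + (vec x * (vec y).conj + (‖y‖ ^ 2) • (1 : Cl m))
    - (‖x‖ ^ 2) • (1 : Cl m) - (‖y‖ ^ 2) • (1 : Cl m) := by abel
  rw [this, h]; abel

/-- `|1 - ā x|^2 = 1 - 2⟨a, x⟩ + |a|^2 |x|^2`. -/
def quad (a x : E m) : ℝ := 1 - 2 * ⟪a, x⟫ + ‖a‖ ^ 2 * ‖x‖ ^ 2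

lemma quad_comm (a x : E m) : quad a x = quad x a := by
  simp [quad, real_inner_comm, mul_comm]

lemma one_sub_mul_conj (a x : E m) :
    ((1 : Cl m) - (vec a).conj * vec x) * ((1 : Cl m) - (vec a).conj * vec x).conj
      = quad a x • (1 : Cl m) := by
  rw [Cl.conj_sub, Cl.conj_mul, Cl.conj_conj, Cl.conj_one, mul_sub, mul_one, sub_mul, one_mul,
    mul_assoc, ← mul_assoc (vec x), vec_mul_conj_self, smul_mul_assoc, one_mul, mul_smul_comm,
    conj_vec_mul_self, smul_smul, quad, add_smul, sub_smul, ← conj_vec_mul_add, one_smul,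
    mul_comm (‖a‖ ^ 2)]
  abel

lemma conj_mul_one_sub (a x : E m) :
    ((1 : Cl m) - (vec a).conj * vec x).conj * ((1 : Cl m) - (vec a).conj * vec x)
      = quad a x • (1 : Cl m) := by
  rw [quad_comm, ← one_sub_mul_conj]
  simp [Cl.conj_sub, Cl.conj_mul]

lemma norm_one_sub_sq (a x : E m) : ‖(1 : Cl m) - (vec a).conj * vec x‖ ^ 2 = quad a x :=
  Cl.norm_sq_smul_one (conj_mul_one_sub a x)

lemma norm_one_sub (a x : E m) : ‖(1 : Cl m) - (vec a).conj * vec x‖ = Real.sqrt (quad a x) := by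
  rw [← norm_one_sub_sq, Real.sqrt_sq (norm_nonneg _)]

lemma quad_pos {a x : E m} (h : ‖a‖ * ‖x‖ < 1) : 0 < quad a x := by
  have h1 := real_inner_le_norm a x
  have : 0 < (1 - ‖a‖ * ‖x‖) ^ 2 := by have : 0 < 1 - ‖a‖ * ‖x‖ := by linarith
                                       positivity
  rw [quad]; nlinarith

lemma szego_eq (a x : E m) :
    szego a x = (Real.sqrt (quad a x) ^ (m + 1))⁻¹ • ((1 : Cl m) - (vec x).conj * vec a) := by
  rw [szego, norm_one_sub]; simp [Cl.conj_sub, Cl.conj_mul]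

lemma conj_szego (a x : E m) : (szego a x).conj = szego x a := by
  rw [szego_eq, szego_eq, Cl.conj_smul, quad_comm]; simp [Cl.conj_sub, Cl.conj_mul]

/-! ### Polar coordinates and fluxes through spheres -/

instance : IsFiniteMeasure (surf m) :=
  inferInstanceAs (IsFiniteMeasure (volume : Measure (E m)).toSphere)

section polar

variable {Y : Type*} [NormedAddCommGroup Y] [NormedSpace ℝ Y]

/-- Integration in polar coordinates. -/
lemma integral_polar {F : E m → Y} (hF : Integrable F) :
    IntegrableOn (fun r : ℝ => r ^ m • ∫ η, F (r • (η : E m)) ∂(surf m)) (Set.Ioi 0) ∧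
    ∫ x, F x = ∫ r in Set.Ioi (0 : ℝ), r ^ m • ∫ η, F (r • (η : E m)) ∂(surf m) := by
  have hdim : Module.finrank ℝ (E m) - 1 = m := by simp
  have hmp := (volume : Measure (E m)).measurePreserving_homeomorphUnitSphereProd
  rw [hdim] at hmp
  have hemb : MeasurableEmbedding (homeomorphUnitSphereProd (E m)) :=
    (homeomorphUnitSphereProd (E m)).measurableEmbedding
  set G : Metric.sphere (0 : E m) 1 × Set.Ioi (0 : ℝ) → Y := fun p => F ((p.2 : ℝ) • (p.1 : E m))
    with hG
  have hcomp : ∀ x : ({0}ᶜ : Set (E m)), G (homeomorphUnitSphereProd (E m) x) = F x := by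
    intro x
    have : ‖(x : E m)‖ ≠ 0 := norm_ne_zero_iff.mpr x.2
    simp [hG, smul_smul, this]
  have hint : Integrable G ((surf m).prod (Measure.volumeIoiPow m)) := by
    rw [surf, ← hmp.integrable_comp_emb hemb]
    have : G ∘ (homeomorphUnitSphereProd (E m)) = F ∘ Subtype.val := funext hcomp
    rw [this, ← integrableOn_iff_comap_subtypeVal (measurableSet_singleton _).compl]
    exact hF.integrableOn
  have h1 : ∫ x, F x = ∫ p, G p ∂((surf m).prod (Measure.volumeIoiPow m)) := by
    rw [surf, ← hmp.integral_comp hemb]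
    simp_rw [hcomp]
    rw [integral_subtype_comap (measurableSet_singleton _).compl F, restrict_compl_singleton]
  have hdens : ∀ r : Set.Ioi (0 : ℝ), (ENNReal.ofReal ((r : ℝ) ^ m)).toReal = (r : ℝ) ^ m :=
    fun r => ENNReal.toReal_ofReal (pow_nonneg (le_of_lt r.2) _)
  have hmeas : Measurable fun r : Set.Ioi (0 : ℝ) => ENNReal.ofReal ((r : ℝ) ^ m) := by fun_prop
  refine ⟨?_, ?_⟩
  · have h2 := hint.integral_prod_right
    rw [Measure.volumeIoiPow, integrable_withDensity_iff_integrable_smul' hmeas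
      (by simp)] at h2
    simp_rw [hdens] at h2
    rwa [integrableOn_iff_comap_subtypeVal measurableSet_Ioi]
  · rw [h1, integral_prod_symm _ hint, Measure.volumeIoiPow,
      integral_withDensity_eq_integral_toReal_smul hmeas (by simp)]
    simp_rw [hdens]
    exact integral_subtype_comap measurableSet_Ioi
      (fun r : ℝ => r ^ m • ∫ η, F (r • (η : E m)) ∂(surf m))

/-- A smooth cutoff on the line: `1` on `(-∞, r₁]`, `0` on `[r₂, ∞)`, decreasing between. -/
def cutoff (r₁ r₂ t : ℝ) : ℝ := Real.smoothTransition ((r₂ - t) / (r₂ - r₁))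

variable {r₁ r₂ : ℝ}

lemma cutoff_of_le (h : r₁ < r₂) {t : ℝ} (ht : t ≤ r₁) : cutoff r₁ r₂ t = 1 :=
  Real.smoothTransition.one_of_one_le (by rw [le_div_iff₀ (by linarith)]; linarith)

lemma cutoff_of_ge (h : r₁ < r₂) {t : ℝ} (ht : r₂ ≤ t) : cutoff r₁ r₂ t = 0 :=
  Real.smoothTransition.zero_of_nonpos (div_nonpos_of_nonpos_of_nonneg (by linarith) (by linarith))

lemma contDiff_cutoff : ContDiff ℝ 1 (cutoff r₁ r₂) :=
  (Real.smoothTransition.contDiff (n := 1)).comp (by fun_prop)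

lemma antitone_cutoff (h : r₁ < r₂) : Antitone (cutoff r₁ r₂) := fun s t hst =>
  Real.smoothTransition.monotone (div_le_div_of_nonneg_right (by linarith) (by linarith))

lemma deriv_cutoff_nonpos (h : r₁ < r₂) (t : ℝ) : deriv (cutoff r₁ r₂) t ≤ 0 :=
  (antitone_cutoff h).deriv_nonpos

lemma deriv_cutoff_of_lt (h : r₁ < r₂) {t : ℝ} (ht : t < r₁) : deriv (cutoff r₁ r₂) t = 0 := by
  have : cutoff r₁ r₂ =ᶠ[𝓝 t] fun _ => 1 := by
    filter_upwards [Iio_mem_nhds ht] with s hs using cutoff_of_le h hs.le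
  rw [this.deriv_eq, deriv_const]

lemma deriv_cutoff_of_gt (h : r₁ < r₂) {t : ℝ} (ht : r₂ < t) : deriv (cutoff r₁ r₂) t = 0 := by
  have : cutoff r₁ r₂ =ᶠ[𝓝 t] fun _ => 0 := by
    filter_upwards [Ioi_mem_nhds ht] with s hs using cutoff_of_ge h hs.le
  rw [this.deriv_eq, deriv_const]

lemma continuous_deriv_cutoff : Continuous (deriv (cutoff r₁ r₂)) :=
  contDiff_cutoff.continuous_deriv le_rfl

lemma integral_deriv_cutoff (h : r₁ < r₂) :
    ∫ t in Set.Icc r₁ r₂, deriv (cutoff r₁ r₂) t = -1 := by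
  rw [integral_Icc_eq_integral_Ioc, ← intervalIntegral.integral_of_le h.le,
    intervalIntegral.integral_deriv_eq_sub
      (fun t _ => (contDiff_cutoff.differentiable one_ne_zero).differentiableAt)
      (continuous_deriv_cutoff.intervalIntegrable _ _),
    cutoff_of_ge h le_rfl, cutoff_of_le h le_rfl]
  norm_num

/-- If the fluxes of `W` through the spheres about `c` with radii in `[r₁, r₂]` are `ε`-close to
`L`, then pairing `W` with the gradient of a radial cutoff gives `-L` up to `ε`. -/
lemma norm_integral_flux_add_le [CompleteSpace Y] (h0 : 0 < r₁) (h : r₁ < r₂) (c : E m)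
    (W : E m → E m →L[ℝ] Y) (hW : ContinuousOn W {x | ‖x - c‖ ∈ Set.Icc r₁ r₂}) (L : Y) (ε : ℝ)
    (hL : ∀ r ∈ Set.Icc r₁ r₂,
      ‖r ^ m • ∫ η, W (c + r • (η : E m)) (η : E m) ∂(surf m) - L‖ ≤ ε) :
    Integrable (fun x => (deriv (cutoff r₁ r₂) ‖x - c‖ * ‖x - c‖⁻¹) • W x (x - c)) ∧
    ‖(∫ x, (deriv (cutoff r₁ r₂) ‖x - c‖ * ‖x - c‖⁻¹) • W x (x - c)) + L‖ ≤ ε := by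
  set φ := deriv (cutoff r₁ r₂) with hφ
  set A : Set (E m) := {x | ‖x - c‖ ∈ Set.Icc r₁ r₂} with hA
  have hAc : IsCompact A := by
    refine (isCompact_closedBall c r₂).of_isClosed_subset ?_ ?_
    · exact isClosed_Icc.preimage (by fun_prop)
    · intro x hx; rw [Metric.mem_closedBall, dist_eq_norm]; exact hx.2
  have hφ0 : ∀ t, t ∉ Set.Icc r₁ r₂ → φ t = 0 := by
    intro t ht
    rw [Set.mem_Icc, not_and_or, not_le, not_le] at ht
    exact ht.elim (deriv_cutoff_of_lt h) (deriv_cutoff_of_gt h)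
  set g : E m → Y := fun x => (φ ‖x - c‖ * ‖x - c‖⁻¹) • W x (x - c) with hg
  have hgi : Integrable g := by
    rw [← integrableOn_iff_integrable_of_support_subset (s := A)]
    · refine ContinuousOn.integrableOn_compact hAc ?_
      refine ContinuousOn.smul (ContinuousOn.mul ?_ ?_) (hW.clm_apply (by fun_prop))
      · exact (continuous_deriv_cutoff.comp (by fun_prop)).continuousOn
      · refine ContinuousOn.inv₀ (by fun_prop) fun x hx => ?_
        exact (h0.trans_le hx.1).ne'
    · intro x hx
      by_contra hxA
      exact hx (by simp [hg, hφ0 _ hxA])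
  refine ⟨hgi, ?_⟩
  have hgi' : Integrable fun x => g (c + x) := hgi.comp_add_left c
  obtain ⟨hi, he⟩ := integral_polar hgi'
  rw [integral_add_left_eq_self] at he
  set k : ℝ → Y := fun r => r ^ m • ∫ η, W (c + r • (η : E m)) (η : E m) ∂(surf m) with hk
  have hrad : ∀ r ∈ Set.Ioi (0 : ℝ),
      (r ^ m • ∫ η, g (c + r • (η : E m)) ∂(surf m)) = φ r • k r := by
    intro r hr
    have hr' : (0 : ℝ) < r := hr
    have : ∀ η : Metric.sphere (0 : E m) 1, g (c + r • (η : E m))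
        = φ r • W (c + r • (η : E m)) (η : E m) := by
      intro η
      simp only [hg, add_sub_cancel_left, norm_smul, Real.norm_of_nonneg hr'.le,
        norm_eq_of_mem_sphere, mul_one, map_smul, smul_smul]
      rw [mul_assoc, inv_mul_cancel₀ hr'.ne', mul_one]
    simp_rw [this, integral_smul]
    rw [smul_comm]
  rw [he, setIntegral_congr_fun measurableSet_Ioi hrad]
  have hi2 : IntegrableOn (fun r => φ r • k r) (Set.Ioi 0) :=
    hi.congr_fun hrad measurableSet_Ioi
  have hsub : Set.Icc r₁ r₂ ⊆ Set.Ioi 0 := fun t ht => h0.trans_le ht.1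
  have hφi : IntegrableOn φ (Set.Icc r₁ r₂) :=
    continuous_deriv_cutoff.continuousOn.integrableOn_compact isCompact_Icc
  have e1 : ∫ r in Set.Ioi 0, φ r • k r = ∫ r in Set.Icc r₁ r₂, φ r • k r :=
    (setIntegral_eq_of_subset_of_forall_sdiff_eq_zero measurableSet_Ioi hsub
      fun t ht => by simp [hφ0 t ht.2])
  have e2 : L = -∫ r in Set.Icc r₁ r₂, φ r • L := by
    rw [integral_smul_const, integral_deriv_cutoff h]; simp
  have e3 : (∫ r in Set.Ioi 0, φ r • k r) + L = ∫ r in Set.Icc r₁ r₂, φ r • (k r - L) := by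
    rw [e1]
    conv_lhs => rw [e2]
    rw [← sub_eq_add_neg, ← integral_sub (hi2.mono_set hsub) (hφi.smul_const L)]
    simp_rw [smul_sub]
  rw [e3]
  calc _ ≤ ∫ r in Set.Icc r₁ r₂, -φ r * ε := by
        refine norm_integral_le_of_norm_le (hφi.neg.mul_const ε) ?_
        filter_upwards [ae_restrict_mem measurableSet_Icc] with r hr
        rw [norm_smul, Real.norm_of_nonpos (deriv_cutoff_nonpos h r)]
        exact mul_le_mul_of_nonneg_left (hL r hr) (neg_nonneg.mpr (deriv_cutoff_nonpos h r))
    _ = ε := by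
        rw [integral_mul_const, integral_neg, integral_deriv_cutoff h]; simp

end polar

/-! ### The Cauchy and Szegő kernels are monogenic -/

section calculus

variable {V : Type*} [NormedAddCommGroup V] [NormedSpace ℝ V] {f g : V → Cl m} {x : V}

lemma hasFDerivAt_mul {f' g' : V →L[ℝ] Cl m} (hf : HasFDerivAt f f' x) (hg : HasFDerivAt g g' x) :
    HasFDerivAt (fun y => f y * g y)
      ((Cl.mulL (f x)).comp g' + (Cl.mulL.flip (g x)).comp f') x := by
  have := Cl.mulL.hasFDerivAt_of_bilinear hf hg
  refine this.congr_fderiv ?_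
  ext v; simp

lemma contDiffAt_mul {n : WithTop ℕ∞} (hf : ContDiffAt ℝ n f x) (hg : ContDiffAt ℝ n g x) :
    ContDiffAt ℝ n (fun y => f y * g y) x :=
  (Cl.mulL.contDiff.contDiffAt.comp x hf).clm_apply hg

end calculus

/-- The derivative of `t ↦ |t|^{-(m+1)/2}`. -/
lemma hasDerivAt_inv_sqrt_pow (m : ℕ) {t : ℝ} (ht : 0 < t) :
    HasDerivAt (fun t => (Real.sqrt t ^ (m + 1))⁻¹)
      (-((m + 1) / 2) * (Real.sqrt t ^ (m + 1))⁻¹ * t⁻¹) t := by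
  have hs : 0 < Real.sqrt t := Real.sqrt_pos.mpr ht
  have h := ((Real.hasDerivAt_sqrt ht.ne').pow (m + 1)).inv (pow_pos hs _).ne'
  refine h.congr_deriv ?_
  have e : t⁻¹ = (Real.sqrt t ^ 2)⁻¹ := by rw [Real.sq_sqrt ht.le]
  rw [e]
  field_simp
  simp
  ring

lemma sum_eVec_mul_conj :
    ∑ i : Fin (m + 1), eVec i * (eVec i).conj = ((m : ℝ) + 1) • (1 : Cl m) := by
  have : ∀ i : Fin (m + 1), eVec i * (eVec i).conj = (1 : ℝ) • (1 : Cl m) := fun i => by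
    rw [← vec_single, vec_mul_conj_self]; simp
  simp_rw [this]
  rw [Finset.sum_const, ← Nat.cast_smul_eq_nsmul ℝ]; simp

lemma sum_conj_mul_eVec :
    ∑ i : Fin (m + 1), (eVec i).conj * eVec i = ((m : ℝ) + 1) • (1 : Cl m) := by
  have : ∀ i : Fin (m + 1), (eVec i).conj * eVec i = (1 : ℝ) • (1 : Cl m) := fun i => by
    rw [← vec_single, conj_vec_mul_self]; simp
  simp_rw [this]
  rw [Finset.sum_const, ← Nat.cast_smul_eq_nsmul ℝ]; simp

lemma sum_inner_smul_eVec (u : E m) :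
    ∑ i : Fin (m + 1), ⟪u, EuclideanSpace.single i (1 : ℝ)⟫ • eVec i = vec u := by
  simp [vec, EuclideanSpace.inner_single_right]

/-- The Cauchy kernel `conj (x - a) / |x - a|^{m+1}`. -/
def cauchyKernel (a x : E m) : Cl m := (‖x - a‖ ^ (m + 1))⁻¹ • (vec (x - a)).conj

lemma cauchyKernel_eq (a x : E m) :
    cauchyKernel a x = (Real.sqrt (‖x - a‖ ^ 2) ^ (m + 1))⁻¹ • Cl.conjL (vecL (x - a)) := by
  rw [Real.sqrt_sq (norm_nonneg _)]; rfl

lemma hasFDerivAt_norm_sub_sq (a x : E m) :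
    HasFDerivAt (fun x : E m => ‖x - a‖ ^ 2) (2 • innerSL ℝ (x - a)) x := by
  have := ((hasFDerivAt_id (𝕜 := ℝ) x).sub_const a).norm_sq
  simpa using this

lemma hasFDerivAt_cauchyKernel {a x : E m} (h : x ≠ a) :
    ∃ G' : E m →L[ℝ] Cl m, HasFDerivAt (cauchyKernel a) G' x ∧
      ∑ i : Fin (m + 1), G' (EuclideanSpace.single i 1) * eVec i = 0 := by
  have hpos : 0 < ‖x - a‖ ^ 2 := by
    have : 0 < ‖x - a‖ := norm_pos_iff.mpr (sub_ne_zero.mpr h)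
    positivity
  have h1 := (hasDerivAt_inv_sqrt_pow m hpos).comp_hasFDerivAt x (hasFDerivAt_norm_sub_sq a x)
  have h2 : HasFDerivAt (fun x : E m => Cl.conjL (vecL (x - a))) (Cl.conjL.comp vecL) x :=
    (Cl.conjL.comp vecL).hasFDerivAt.comp x ((hasFDerivAt_id x).sub_const a)
  have h3 := h1.smul h2
  refine ⟨_, h3.congr_of_eventuallyEq (Eventually.of_forall fun y => cauchyKernel_eq a y), ?_⟩
  simp only [add_apply, smul_apply,
    ContinuousLinearMap.smulRight_apply, ContinuousLinearMap.comp_apply, Function.comp,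
    innerSL_apply_apply, add_mul, smul_mul_assoc, Finset.sum_add_distrib, vecL_apply, vec_single,
    Cl.conjL_apply, ← Finset.smul_sum, sum_conj_mul_eVec]
  set N := (Real.sqrt (‖x - a‖ ^ 2) ^ (m + 1))⁻¹
  have h4 : ∑ i : Fin (m + 1),
      ((-((m + 1 : ℝ) / 2) * N * (‖x - a‖ ^ 2)⁻¹) • (2 : ℕ) •
        ⟪x - a, EuclideanSpace.single i (1 : ℝ)⟫) • ((vec (x - a)).conj * eVec i)
      = (-(m + 1 : ℝ) * N) • (1 : Cl m) := by
    have : ∀ i : Fin (m + 1),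
      ((-((m + 1 : ℝ) / 2) * N * (‖x - a‖ ^ 2)⁻¹) • (2 : ℕ) •
        ⟪x - a, EuclideanSpace.single i (1 : ℝ)⟫) • ((vec (x - a)).conj * eVec i)
        = (-(m + 1 : ℝ) * N * (‖x - a‖ ^ 2)⁻¹) •
        ((vec (x - a)).conj * (⟪x - a, EuclideanSpace.single i (1 : ℝ)⟫ • eVec i)) := by
      intro i
      rw [mul_smul_comm, smul_smul]
      congr 1
      simp only [smul_eq_mul, nsmul_eq_mul]; push_cast; ring
    simp_rw [this]
    rw [← Finset.smul_sum, ← Finset.mul_sum, sum_inner_smul_eVec, conj_vec_mul_self, smul_smul]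
    congr 1
    rw [mul_assoc, inv_mul_cancel₀ hpos.ne', mul_one]
  rw [h4, smul_smul, ← add_smul]
  rw [show N * ((m : ℝ) + 1) + -((m : ℝ) + 1) * N = 0 by ring, zero_smul]

lemma contDiffAt_cauchyKernel {a x : E m} (h : x ≠ a) : ContDiffAt ℝ 1 (cauchyKernel a) x := by
  have h' : x - a ≠ 0 := sub_ne_zero.mpr h
  have h1 : ContDiffAt ℝ 1 (fun x : E m => ‖x - a‖) x :=
    (contDiffAt_id.sub contDiffAt_const).norm ℝ h'
  refine ContDiffAt.smul ((h1.pow _).inv (pow_ne_zero _ (norm_ne_zero_iff.mpr h'))) ?_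
  exact (Cl.conjL.comp vecL).contDiff.contDiffAt.comp x (contDiffAt_id.sub contDiffAt_const)

lemma hasFDerivAt_quad (b x : E m) :
    HasFDerivAt (quad b) (2 • innerSL ℝ (‖b‖ ^ 2 • x - b)) x := by
  have h1 : HasFDerivAt (fun x : E m => ⟪b, x⟫) (innerSL ℝ b) x := (innerSL ℝ b).hasFDerivAt
  have h2 := (hasStrictFDerivAt_norm_sq x).hasFDerivAt
  have h3 := ((h1.const_mul (2 : ℝ)).const_sub 1).add (h2.const_mul (‖b‖ ^ 2))
  refine h3.congr_fderiv ?_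
  ext v
  simp
  ring

lemma hasFDerivAt_szego {b x : E m} (h : 0 < quad b x) :
    ∃ S' : E m →L[ℝ] Cl m, HasFDerivAt (szego b) S' x ∧
      ∑ i : Fin (m + 1), eVec i * S' (EuclideanSpace.single i 1) = 0 := by
  have h1 := (hasDerivAt_inv_sqrt_pow m h).comp_hasFDerivAt x (hasFDerivAt_quad b x)
  have h2 : HasFDerivAt (fun x : E m => (1 : Cl m) - (vec x).conj * vec b)
      (-((Cl.mulL.flip (vec b)).comp (Cl.conjL.comp vecL))) x :=
    (((Cl.mulL.flip (vec b)).comp (Cl.conjL.comp vecL)).hasFDerivAt).const_sub 1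
  have h3 := h1.smul h2
  refine ⟨_, h3.congr_of_eventuallyEq (Eventually.of_forall fun y => szego_eq b y), ?_⟩
  simp only [add_apply, smul_apply,
    ContinuousLinearMap.smulRight_apply, ContinuousLinearMap.comp_apply, Function.comp,
    neg_apply, ContinuousLinearMap.flip_apply, Cl.mulL_apply,
    innerSL_apply_apply, mul_add, mul_smul_comm, Finset.sum_add_distrib, vecL_apply, vec_single,
    Cl.conjL_apply, ← Finset.smul_sum, mul_neg, ← mul_assoc, Finset.sum_neg_distrib,
    ← Finset.sum_mul, sum_eVec_mul_conj]
  set N := (Real.sqrt (quad b x) ^ (m + 1))⁻¹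
  set zc := (1 : Cl m) - (vec x).conj * vec b with hz
  have h4 : ∑ i : Fin (m + 1), ((-((m + 1 : ℝ) / 2) * N * (quad b x)⁻¹) • (2 : ℕ) •
        ⟪‖b‖ ^ 2 • x - b, EuclideanSpace.single i (1 : ℝ)⟫) • (eVec i * zc)
      = ((m + 1 : ℝ) * N) • vec b := by
    have : ∀ i : Fin (m + 1), ((-((m + 1 : ℝ) / 2) * N * (quad b x)⁻¹) • (2 : ℕ) •
        ⟪‖b‖ ^ 2 • x - b, EuclideanSpace.single i (1 : ℝ)⟫) • (eVec i * zc)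
        = (-(m + 1 : ℝ) * N * (quad b x)⁻¹) •
        ((⟪‖b‖ ^ 2 • x - b, EuclideanSpace.single i (1 : ℝ)⟫ • eVec i) * zc) := by
      intro i
      rw [smul_mul_assoc, smul_smul]
      congr 1
      simp only [smul_eq_mul, nsmul_eq_mul]; push_cast; ring
    simp_rw [this]
    have e1 : vec (‖b‖ ^ 2 • x - b) = -(vec b * ((1 : Cl m) - (vec b).conj * vec x)) := by
      rw [vec_sub, vec_smul, mul_sub, ← mul_assoc, vec_mul_conj_self]; simp
    have e2 : zc = ((1 : Cl m) - (vec b).conj * vec x).conj := by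
      simp [hz, Cl.conj_sub, Cl.conj_mul]
    rw [← Finset.smul_sum, ← Finset.sum_mul, sum_inner_smul_eVec, e1, e2, neg_mul (vec b * _),
      mul_assoc (vec b),
      one_sub_mul_conj, mul_smul_comm, mul_one, smul_neg, ← neg_smul, smul_smul]
    congr 1
    field_simp
  rw [h4, smul_mul_assoc, one_mul, smul_neg, smul_smul]
  rw [mul_comm N]; simp

lemma contDiffAt_szego {n : WithTop ℕ∞} {b x : E m} (h : 0 < quad b x) :
    ContDiffAt ℝ n (szego b) x := by
  have h1 : ContDiffAt ℝ n (quad b) x := by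
    have : ContDiff ℝ n (fun x : E m => 1 - 2 * ⟪b, x⟫ + ‖b‖ ^ 2 * ‖x‖ ^ 2) :=
      (contDiff_const.sub (contDiff_const.mul (contDiff_const.inner ℝ contDiff_id))).add
        (contDiff_const.mul (contDiff_norm_sq ℝ))
    exact this.contDiffAt
  have h2 : ContDiffAt ℝ n (fun x : E m => (1 : Cl m) - (vec x).conj * vec b) x :=
    contDiffAt_const.sub
      ((Cl.mulL.flip (vec b)).comp (Cl.conjL.comp vecL)).contDiff.contDiffAt
  have h3 := (((h1.sqrt h.ne').pow (m + 1)).inv (pow_pos (Real.sqrt_pos.mpr h) _).ne').smul h2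
  exact h3.congr_of_eventuallyEq (Eventually.of_forall fun y => szego_eq b y)

/-- On the unit sphere the Cauchy kernel is the conjugate Szegő kernel. -/
lemma cauchyKernel_mul_vec {a η : E m} (hη : ‖η‖ = 1) :
    cauchyKernel a η * vec η = (szego a η).conj := by
  have h1 : (vec (η - a)).conj * vec η = (1 : Cl m) - (vec a).conj * vec η := by
    rw [vec_sub, Cl.conj_sub, sub_mul, conj_vec_mul_self, hη]; simp
  have h2 : Real.sqrt (quad a η) = ‖η - a‖ := by
    rw [quad, hη, ← Real.sqrt_sq (norm_nonneg (η - a)), norm_sub_sq_real, hη,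
      real_inner_comm]
    congr 1; ring
  rw [cauchyKernel, smul_mul_assoc, h1, szego, Cl.conj_smul, Cl.conj_conj, norm_one_sub, h2]

/-! ### Cauchy's formula on the ball -/

lemma contDiff_cutoff_norm {r₁ r₂ : ℝ} (h0 : 0 < r₁) (h : r₁ < r₂) (c : E m) :
    ContDiff ℝ 1 (fun x : E m => cutoff r₁ r₂ ‖x - c‖) := by
  rw [contDiff_iff_contDiffAt]
  intro x
  by_cases hx : x = c
  · have : (fun x : E m => cutoff r₁ r₂ ‖x - c‖) =ᶠ[𝓝 x] fun _ => 1 := by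
      filter_upwards [Metric.ball_mem_nhds x h0] with y hy
      rw [Metric.mem_ball, dist_eq_norm, hx] at hy
      exact cutoff_of_le h hy.le
    exact contDiffAt_const.congr_of_eventuallyEq this
  · exact contDiff_cutoff.contDiffAt.comp x
      ((contDiffAt_id.sub contDiffAt_const).norm ℝ (sub_ne_zero.mpr hx))

lemma hasFDerivAt_cutoff_norm {r₁ r₂ : ℝ} (h0 : 0 < r₁) (h : r₁ < r₂) (c x : E m) :
    HasFDerivAt (fun x : E m => cutoff r₁ r₂ ‖x - c‖)
      ((deriv (cutoff r₁ r₂) ‖x - c‖ * ‖x - c‖⁻¹) • innerSL ℝ (x - c)) x := by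
  by_cases hx : x = c
  · have : (fun x : E m => cutoff r₁ r₂ ‖x - c‖) =ᶠ[𝓝 x] fun _ => 1 := by
      filter_upwards [Metric.ball_mem_nhds x h0] with y hy
      rw [Metric.mem_ball, dist_eq_norm, hx] at hy
      exact cutoff_of_le h hy.le
    refine ((hasFDerivAt_const (1 : ℝ) x).congr_of_eventuallyEq this).congr_fderiv ?_
    simp [hx]
  · have hn : 0 < ‖x - c‖ := norm_pos_iff.mpr (sub_ne_zero.mpr hx)
    have h1 : HasFDerivAt (fun x : E m => ‖x - c‖) (‖x - c‖⁻¹ • innerSL ℝ (x - c)) x := by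
      have := (Real.hasDerivAt_sqrt (pow_pos hn 2).ne').comp_hasFDerivAt x
        (hasFDerivAt_norm_sub_sq c x)
      refine (this.congr_of_eventuallyEq (Eventually.of_forall fun y => ?_)).congr_fderiv ?_
      · simp [Real.sqrt_sq (norm_nonneg _)]
      · rw [Real.sqrt_sq hn.le, two_nsmul, ← two_smul ℝ, smul_smul]
        congr 1; field_simp
    have h2 := ((contDiff_cutoff (r₁ := r₁) (r₂ := r₂)).differentiable
      one_ne_zero).differentiableAt.hasDerivAt (x := ‖x - c‖)
    refine (h2.comp_hasFDerivAt x h1).congr_fderiv ?_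
    rw [smul_smul]

lemma integral_fderiv_eq_zero {H : E m → Cl m} (h : ContDiff ℝ 1 H) (hc : HasCompactSupport H)
    (v : E m) : Integrable (fun x => fderiv ℝ H x v) ∧ ∫ x, fderiv ℝ H x v = 0 := by
  have hi : Integrable (fun x => fderiv ℝ H x v) :=
    ((h.continuous_fderiv one_ne_zero).clm_apply continuous_const).integrable_of_hasCompactSupport
      (hc.fderiv_apply ℝ v)
  have := integral_smul_fderiv_eq_neg_fderiv_smul_of_integrable (μ := volume)
    (f := fun _ : E m => (1 : ℝ)) (g := H) (v := v) (by simp) (by simpa using hi)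
    (by simpa using h.continuous.integrable_of_hasCompactSupport hc) (by simp)
    (fun x _ => (h.differentiable one_ne_zero).differentiableAt)
  exact ⟨hi, by simpa using this⟩

/-- The Cauchy form `v ↦ G v f` of `f` with respect to the Cauchy kernel `G` at `a`. -/
def cauchyForm (a : E m) (f : E m → Cl m) (x : E m) : E m →L[ℝ] Cl m :=
  (Cl.mulL.flip (f x)).comp ((Cl.mulL (cauchyKernel a x)).comp vecL)

lemma cauchyForm_apply (a : E m) (f : E m → Cl m) (x v : E m) :
    cauchyForm a f x v = cauchyKernel a x * vec v * f x := rfl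

lemma continuousOn_cauchyForm {a : E m} {f : E m → Cl m} {s : Set (E m)} (hf : ContinuousOn f s)
    (hs : a ∉ s) : ContinuousOn (cauchyForm a f) s := by
  have hG : ContinuousOn (cauchyKernel a) s := fun x hx =>
    (contDiffAt_cauchyKernel (fun h : x = a => hs (by rwa [← h]))).continuousAt.continuousWithinAt
  refine ContinuousOn.clm_comp (Cl.mulL.flip.continuous.comp_continuousOn hf) ?_
  exact (Cl.mulL.continuous.comp_continuousOn hG).clm_comp continuousOn_const

/-- Stokes' theorem between a small sphere about `a` and a large sphere about `0`: the Cauchy form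
is closed away from `a`, so it pairs with the gradients of both radial cutoffs to the same value. -/
lemma integral_cauchyForm_eq {R : ℝ} {f : E m → Cl m} (hf : ContDiffOn ℝ 1 f (Metric.ball 0 R))
    (hD : ∀ x ∈ Metric.ball (0 : E m) R,
      ∑ i : Fin (m + 1), eVec i * fderiv ℝ f x (EuclideanSpace.single i 1) = 0)
    {a : E m} {r₁ r₂ s₁ s₂ : ℝ} (hr₁ : 0 < r₁) (hr : r₁ < r₂) (hR : r₂ < R) (hs₁ : 0 < s₁)
    (hs : s₁ < s₂) (has : ‖a‖ + s₂ < r₁)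
    (hi1 : Integrable fun x =>
      (deriv (cutoff r₁ r₂) ‖x - 0‖ * ‖x - 0‖⁻¹) • cauchyForm a f x (x - 0))
    (hi2 : Integrable fun x =>
      (deriv (cutoff s₁ s₂) ‖x - a‖ * ‖x - a‖⁻¹) • cauchyForm a f x (x - a)) :
    ∫ x, (deriv (cutoff r₁ r₂) ‖x - 0‖ * ‖x - 0‖⁻¹) • cauchyForm a f x (x - 0)
      = ∫ x, (deriv (cutoff s₁ s₂) ‖x - a‖ * ‖x - a‖⁻¹) • cauchyForm a f x (x - a) := by
  set χ : E m → ℝ := fun x => cutoff r₁ r₂ ‖x - 0‖ - cutoff s₁ s₂ ‖x - a‖ with hχ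
  set p : E m → ℝ := fun x => deriv (cutoff r₁ r₂) ‖x - 0‖ * ‖x - 0‖⁻¹ with hp
  set q : E m → ℝ := fun x => deriv (cutoff s₁ s₂) ‖x - a‖ * ‖x - a‖⁻¹ with hq
  have hχd : ContDiff ℝ 1 χ := (contDiff_cutoff_norm hr₁ hr 0).sub (contDiff_cutoff_norm hs₁ hs a)
  have hχ' : ∀ x, HasFDerivAt χ (p x • innerSL ℝ (x - 0) - q x • innerSL ℝ (x - a)) x := fun x =>
    (hasFDerivAt_cutoff_norm hr₁ hr 0 x).sub (hasFDerivAt_cutoff_norm hs₁ hs a x)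
  -- near `a` and outside the ball of radius `r₂` the cutoff `χ` vanishes
  set U : Set (E m) := Metric.ball a s₁ ∪ {x | r₂ < ‖x‖} with hU
  have hUo : IsOpen U := Metric.isOpen_ball.union (isOpen_lt continuous_const continuous_norm)
  have hcase : ∀ x ∈ U, χ x = 0 ∧ p x = 0 ∧ q x = 0 := by
    rintro x (hx | hx)
    · rw [Metric.mem_ball, dist_eq_norm] at hx
      have h1 : ‖x - 0‖ < r₁ := by
        rw [sub_zero]
        have : ‖x‖ ≤ ‖x - a‖ + ‖a‖ := by simpa using norm_add_le (x - a) a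
        linarith
      simp only [hχ, hp, hq]
      rw [cutoff_of_le hr h1.le, cutoff_of_le hs hx.le, deriv_cutoff_of_lt hr h1,
        deriv_cutoff_of_lt hs hx]
      simp
    · have h1 : r₂ < ‖x - 0‖ := by rw [sub_zero]; exact hx
      have h2 : s₂ < ‖x - a‖ := by
        have : ‖x‖ ≤ ‖x - a‖ + ‖a‖ := by simpa using norm_add_le (x - a) a
        rw [sub_zero] at h1
        linarith
      simp only [hχ, hp, hq]
      rw [cutoff_of_ge hr h1.le, cutoff_of_ge hs h2.le, deriv_cutoff_of_gt hr h1,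
        deriv_cutoff_of_gt hs h2]
      simp
  have hout : ∀ x, x ∉ U → x ≠ a ∧ x ∈ Metric.ball (0 : E m) R := by
    intro x hx
    rw [hU, Set.mem_union, not_or] at hx
    refine ⟨fun h => hx.1 (h ▸ Metric.mem_ball_self hs₁), ?_⟩
    have : ¬ r₂ < ‖x‖ := hx.2
    rw [Metric.mem_ball, dist_zero_right]; linarith
  set H : Fin (m + 1) → E m → Cl m := fun i x => χ x • (cauchyKernel a x * eVec i * f x) with hH
  have hH0 : ∀ i, ∀ x ∈ U, H i =ᶠ[𝓝 x] fun _ => 0 := by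
    intro i x hx
    filter_upwards [hUo.mem_nhds hx] with y hy
    simp [hH, (hcase y hy).1]
  have hfd : ∀ x ∈ Metric.ball (0 : E m) R, ContDiffAt ℝ 1 f x := fun x hx =>
    hf.contDiffAt (Metric.isOpen_ball.mem_nhds hx)
  have hHd : ∀ i, ContDiff ℝ 1 (H i) := by
    intro i
    rw [contDiff_iff_contDiffAt]
    intro x
    by_cases hx : x ∈ U
    · exact contDiffAt_const.congr_of_eventuallyEq (hH0 i x hx)
    · obtain ⟨h1, h2⟩ := hout x hx
      exact hχd.contDiffAt.smul (contDiffAt_mul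
        (contDiffAt_mul (contDiffAt_cauchyKernel h1) contDiffAt_const) (hfd x h2))
  have hHc : ∀ i, HasCompactSupport (H i) := by
    intro i
    refine HasCompactSupport.intro (isCompact_closedBall (0 : E m) r₂) fun x hx => ?_
    rw [Metric.mem_closedBall, dist_zero_right, not_le] at hx
    exact (hH0 i x (Or.inr hx)).self_of_nhds
  have hsum : ∀ x, ∑ i, fderiv ℝ (H i) x (EuclideanSpace.single i 1)
      = p x • cauchyForm a f x (x - 0) - q x • cauchyForm a f x (x - a) := by
    intro x
    by_cases hx : x ∈ U
    · obtain ⟨-, h2, h3⟩ := hcase x hx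
      rw [h2, h3]
      simp [(hH0 _ x hx).fderiv_eq]
    · obtain ⟨h1, h2⟩ := hout x hx
      obtain ⟨G', hG', hG0⟩ := hasFDerivAt_cauchyKernel h1
      have hf' := ((hfd x h2).differentiableAt one_ne_zero).hasFDerivAt
      have hHi : ∀ i, fderiv ℝ (H i) x (EuclideanSpace.single i 1)
          = χ x • (cauchyKernel a x * (eVec i * fderiv ℝ f x (EuclideanSpace.single i 1)))
            + χ x • (G' (EuclideanSpace.single i 1) * eVec i * f x)
            + (cauchyKernel a x * ((p x * ⟪x - 0, EuclideanSpace.single i (1 : ℝ)⟫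
              - q x * ⟪x - a, EuclideanSpace.single i (1 : ℝ)⟫) • eVec i) * f x) := by
        intro i
        have hHi : HasFDerivAt (H i) _ x := (hχ' x).smul (hasFDerivAt_mul
          (hasFDerivAt_mul hG' (hasFDerivAt_const (eVec i) x)) hf')
        rw [hHi.fderiv]
        simp [mul_assoc, inner_sub_left]
      simp_rw [hHi, Finset.sum_add_distrib, ← Finset.smul_sum, ← Finset.sum_mul, ← Finset.mul_sum,
        hD x h2, hG0, sub_smul, Finset.sum_sub_distrib, mul_smul, ← Finset.smul_sum,
        sum_inner_smul_eVec, cauchyForm_apply]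
      simp [mul_sub, sub_mul]
  have key : ∫ x, (p x • cauchyForm a f x (x - 0) - q x • cauchyForm a f x (x - a)) = 0 := by
    simp_rw [← hsum]
    rw [integral_finsetSum _ fun i _ => (integral_fderiv_eq_zero (hHd i) (hHc i) _).1]
    exact Finset.sum_eq_zero fun i _ => (integral_fderiv_eq_zero (hHd i) (hHc i) _).2
  rw [integral_sub hi1 hi2] at key
  exact sub_eq_zero.mp key

lemma surf_real_univ_pos : 0 < (surf m).real Set.univ := by
  have : surf m ≠ 0 := (volume : Measure (E m)).toSphere_ne_zero
  rw [measureReal_def]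
  exact ENNReal.toReal_pos (by simpa using this) (measure_ne_top _ _)

/-- Cauchy's formula: the reproducing property of the Szegő kernel for functions that are monogenic
past the closed ball. -/
theorem cauchy_formula {R : ℝ} (hR : 1 < R) {f : E m → Cl m}
    (hf : ContDiffOn ℝ 1 f (Metric.ball 0 R))
    (hD : ∀ x ∈ Metric.ball (0 : E m) R,
      ∑ i : Fin (m + 1), eVec i * fderiv ℝ f x (EuclideanSpace.single i 1) = 0)
    {a : E m} (ha : ‖a‖ < 1) :
    f a = ⨍ η, (szego a (η : E m)).conj * f (η : E m) ∂(surf m) := by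
  set A := (surf m).real Set.univ with hA
  have hApos : 0 < A := surf_real_univ_pos
  set I := ∫ η, (szego a (η : E m)).conj * f (η : E m) ∂(surf m) with hI
  suffices h : I = A • f a by
    rw [average_eq, ← hI, h, smul_smul, inv_mul_cancel₀ hApos.ne', one_smul]
  have hfc : ContinuousOn f (Metric.ball 0 R) := hf.continuousOn
  -- it suffices to show equality up to `2 * ε`
  refine eq_of_forall_dist_le fun ε hε => ?_
  -- the outer radii
  set k : ℝ → Cl m := fun r => r ^ m • ∫ η, cauchyForm a f (0 + r • (η : E m)) (η : E m) ∂(surf m)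
    with hk
  have hk1 : k 1 = I := by
    simp only [hk, one_pow, one_smul, zero_add, hI]
    refine integral_congr_ae (Eventually.of_forall fun η => ?_)
    simp only [cauchyForm_apply]
    rw [cauchyKernel_mul_vec (norm_eq_of_mem_sphere η)]
  have hkc : ContinuousAt k 1 := by
    obtain ⟨ρ, hρ1, hρ2⟩ := exists_between ha
    have hcont : ContinuousOn (fun r : ℝ => ∫ η, cauchyForm a f (0 + r • (η : E m)) (η : E m)
        ∂(surf m)) (Set.Ioo ρ R) := by
      have hρ0 : 0 < ρ := (norm_nonneg a).trans_lt hρ1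
      have h3 : ContinuousOn (Function.uncurry fun (r : ℝ) (η : Metric.sphere (0 : E m) 1) =>
          cauchyForm a f (0 + r • (η : E m)) (η : E m)) (Set.Ioo ρ R ×ˢ Set.univ) := by
        have h4 : ContinuousOn (cauchyForm a f) {x | ρ < ‖x‖ ∧ ‖x‖ < R} :=
          continuousOn_cauchyForm (hfc.mono fun x hx => by simpa using hx.2)
            fun h => (hρ1.trans h.1).false
        refine ContinuousOn.clm_apply (h4.comp (by fun_prop) ?_) (by fun_prop)
        rintro ⟨r, η⟩ ⟨hr, -⟩
        have : ‖r • (η : E m)‖ = r := by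
          rw [norm_smul, norm_eq_of_mem_sphere, mul_one, Real.norm_of_nonneg (hρ0.trans hr.1).le]
        simpa [this] using hr
      intro r hr
      refine ContinuousAt.continuousWithinAt ?_
      obtain ⟨u, hu1, hu2⟩ := exists_between hr.1
      obtain ⟨w, hw1, hw2⟩ := exists_between hr.2
      have h5 : ContinuousOn (Function.uncurry fun (r : ℝ) (η : Metric.sphere (0 : E m) 1) =>
          cauchyForm a f (0 + r • (η : E m)) (η : E m)) (Set.Icc u w ×ˢ Set.univ) :=
        h3.mono (Set.prod_mono (fun t ht => ⟨hu1.trans_le ht.1, ht.2.trans_lt hw2⟩) subset_rfl)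
      have h6 := continuousOn_integral_of_compact_support (μ := surf m)
        (k := (Set.univ : Set (Metric.sphere (0 : E m) 1))) isCompact_univ h5 (by simp)
      exact h6.continuousAt (Icc_mem_nhds hu2 hw1)
    exact (continuousAt_id.pow m).smul (hcont.continuousAt (Ioo_mem_nhds hρ2 hR))
  obtain ⟨d, hd, hdk⟩ := Metric.continuousAt_iff.mp hkc (ε / 2) (half_pos hε)
  set δ := min (d / 2) (min ((1 - ‖a‖) / 2) ((R - 1) / 2)) with hδ
  have hδ0 : 0 < δ := by
    refine lt_min (by linarith) (lt_min (by linarith) (by linarith))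
  have hδ1 : δ ≤ d / 2 := min_le_left _ _
  have hδ2 : δ ≤ (1 - ‖a‖) / 2 := (min_le_right _ _).trans (min_le_left _ _)
  have hδ3 : δ ≤ (R - 1) / 2 := (min_le_right _ _).trans (min_le_right _ _)
  have hna := norm_nonneg a
  obtain ⟨hi1, he1⟩ := norm_integral_flux_add_le (r₁ := 1 - δ) (r₂ := 1 + δ) (by linarith)
    (by linarith) (0 : E m) (cauchyForm a f)
    (continuousOn_cauchyForm (hfc.mono fun x hx => by
        have := hx.2
        rw [sub_zero] at this
        rw [Metric.mem_ball, dist_zero_right]; linarith)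
      (fun h => by have := h.1; rw [sub_zero] at this; linarith)) I (ε / 2) (by
      intro r hr
      have := hdk (x := r) (by rw [Real.dist_eq, abs_lt]; constructor <;> linarith [hr.1, hr.2])
      rw [hk1, dist_eq_norm] at this
      exact this.le)
  -- the inner radii
  have hfa : ContinuousAt f a := hfc.continuousAt
    (Metric.isOpen_ball.mem_nhds (by rw [Metric.mem_ball, dist_zero_right]; linarith))
  obtain ⟨d', hd', hdf⟩ := Metric.continuousAt_iff.mp hfa (ε / 2 / A) (by positivity)
  set σ := min (d' / 3) ((1 - ‖a‖) / 8) with hσ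
  have hσ0 : 0 < σ := lt_min (by linarith) (by linarith)
  have hσ1 : σ ≤ d' / 3 := min_le_left _ _
  have hσ2 : σ ≤ (1 - ‖a‖) / 8 := min_le_right _ _
  have hball : ∀ x : E m, ‖x - a‖ ≤ 2 * σ → x ∈ Metric.ball (0 : E m) R := by
    intro x hx
    have : ‖x‖ ≤ ‖x - a‖ + ‖a‖ := by simpa using norm_add_le (x - a) a
    rw [Metric.mem_ball, dist_zero_right]; linarith
  obtain ⟨hi2, he2⟩ := norm_integral_flux_add_le (r₁ := σ) (r₂ := 2 * σ) hσ0
    (by linarith) a (cauchyForm a f)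
    (continuousOn_cauchyForm (hfc.mono fun x hx => hball x hx.2)
      (fun h => by have := h.1; simp at this; linarith)) (A • f a) (ε / 2) (by
      intro r hr
      have hr0 : 0 < r := hσ0.trans_le hr.1
      have e1 : ∀ η : Metric.sphere (0 : E m) 1,
          cauchyForm a f (a + r • (η : E m)) (η : E m) = (r ^ m)⁻¹ • f (a + r • (η : E m)) := by
        intro η
        rw [cauchyForm_apply, cauchyKernel, add_sub_cancel_left, norm_smul, norm_eq_of_mem_sphere,
          mul_one, Real.norm_of_nonneg hr0.le, vec_smul, Cl.conj_smul, smul_smul, smul_mul_assoc,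
          conj_vec_mul_self, norm_eq_of_mem_sphere, one_pow, one_smul, smul_mul_assoc, one_mul]
        congr 1
        field_simp
        rw [pow_succ']
      simp_rw [e1]
      rw [integral_smul, smul_smul, mul_inv_cancel₀ (pow_pos hr0 m).ne', one_smul]
      have hnorm : ∀ η : Metric.sphere (0 : E m) 1, ‖a + r • (η : E m) - a‖ = r := fun η => by
        rw [add_sub_cancel_left, norm_smul, norm_eq_of_mem_sphere, mul_one,
          Real.norm_of_nonneg hr0.le]
      have hcont : Continuous fun η : Metric.sphere (0 : E m) 1 => f (a + r • (η : E m)) :=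
        hfc.comp_continuous (by fun_prop) fun η => hball _ ((hnorm η).trans_le hr.2)
      have hint : Integrable (fun η : Metric.sphere (0 : E m) 1 => f (a + r • (η : E m)))
          (surf m) := hcont.integrable_of_hasCompactSupport (HasCompactSupport.of_compactSpace _)
      have e2 : A • f a = ∫ _ : Metric.sphere (0 : E m) 1, f a ∂(surf m) := by simp [hA]
      rw [e2, ← integral_sub hint (integrable_const _)]
      refine (norm_integral_le_of_norm_le_const (C := ε / 2 / A)
        (Eventually.of_forall fun η => ?_)).trans (le_of_eq ?_)
      · have := hdf (x := a + r • (η : E m)) (by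
          rw [dist_eq_norm, hnorm]; linarith [hr.2])
        rw [dist_eq_norm] at this
        exact this.le
      · rw [← hA]; field_simp)
  have hst := integral_cauchyForm_eq hf hD (a := a) (r₁ := 1 - δ) (r₂ := 1 + δ) (s₁ := σ)
    (s₂ := 2 * σ) (by linarith) (by linarith) (by linarith) hσ0 (by linarith) (by linarith) hi1 hi2
  rw [hst] at he1
  rw [dist_eq_norm]
  set J := ∫ x, (deriv (cutoff σ (2 * σ)) ‖x - a‖ * ‖x - a‖⁻¹) • cauchyForm a f x (x - a)
  calc ‖I - A • f a‖ = ‖(J + I) - (J + A • f a)‖ := by congr 1; abel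
    _ ≤ ‖J + I‖ + ‖J + A • f a‖ := norm_sub_le _ _
    _ ≤ ε := by linarith

/-! ### The Szegő kernel as a smooth map into continuous functions on the closed ball -/

section superposition

variable {T : Type*} [TopologicalSpace T] [CompactSpace T]

/-- Pointwise square root of a continuous function. -/
def sqrtMap (q : C(T, ℝ)) : C(T, ℝ) := ⟨fun x => Real.sqrt (q x), by fun_prop⟩

/-- The pointwise square root is smooth at positive functions, since there it is a local inverse of
squaring in the Banach algebra of continuous functions. -/
lemma contDiffAt_sqrtMap {n : WithTop ℕ∞} (hn : n ≠ 0) {q : C(T, ℝ)} (hq : ∀ x, 0 < q x) :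
    ContDiffAt ℝ n sqrtMap q := by
  set u := sqrtMap q with hu
  have hupos : ∀ x, 0 < u x := fun x => Real.sqrt_pos.mpr (hq x)
  have huu : u * u = q := by ext x; exact Real.mul_self_sqrt (hq x).le
  obtain ⟨w, hw⟩ : IsUnit ((2 : ℝ) • u) := by
    rw [ContinuousMap.isUnit_iff_forall_ne_zero]
    intro x; simpa using (hupos x).ne'
  let e : C(T, ℝ) ≃L[ℝ] C(T, ℝ) := ContinuousLinearEquiv.equivOfInverse
    (ContinuousLinearMap.mul ℝ C(T, ℝ) (w : C(T, ℝ)))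
    (ContinuousLinearMap.mul ℝ C(T, ℝ) ((w⁻¹ : (C(T, ℝ))ˣ) : C(T, ℝ)))
    (fun v => by simp) (fun v => by simp)
  have hsq : ContDiffAt ℝ n (fun v : C(T, ℝ) => v * v) u := contDiffAt_id.mul contDiffAt_id
  have hfd : HasFDerivAt (fun v : C(T, ℝ) => v * v) (e : C(T, ℝ) →L[ℝ] C(T, ℝ)) u := by
    refine ((hasFDerivAt_id u).mul (hasFDerivAt_id u)).congr_fderiv ?_
    ext v x
    simp only [id, add_apply, smul_apply, ContinuousLinearMap.id_apply,
      ContinuousMap.add_apply, smul_eq_mul, e]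
    change u x * v x + _ = (w : C(T, ℝ)) x * v x
    rw [hw]
    simp
    ring
  have hst := hsq.hasStrictFDerivAt' hfd hn
  set g := HasStrictFDerivAt.localInverse _ _ _ hst with hg
  have h1 : ContDiffAt ℝ n g q := by
    have := hsq.to_localInverse hfd hn
    simp only [huu] at this
    exact this
  have h2 : ∀ᶠ p in 𝓝 q, g p * g p = p := by
    have := hst.eventually_right_inverse
    rwa [huu] at this
  have h3 : ∀ᶠ p in 𝓝 q, ∀ x, 0 < g p x := by
    have hopen : IsOpen {v : C(T, ℝ) | Set.MapsTo v Set.univ (Set.Ioi 0)} :=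
      ContinuousMap.isOpen_setOfPred_mapsTo isCompact_univ isOpen_Ioi
    have hq' : g q = u := by
      have := hst.localInverse_apply_image
      rwa [huu] at this
    have := h1.continuousAt.preimage_mem_nhds
      (t := {v : C(T, ℝ) | Set.MapsTo v Set.univ (Set.Ioi 0)})
      (by rw [hq']; exact hopen.mem_nhds fun x _ => hupos x)
    filter_upwards [this] with p hp x using hp (Set.mem_univ x)
  refine h1.congr_of_eventuallyEq ?_
  filter_upwards [h2, h3] with p hp2 hp3
  ext x
  have : g p x * g p x = p x := by
    rw [← ContinuousMap.mul_apply, hp2]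
  change Real.sqrt (p x) = _
  rw [← this, Real.sqrt_mul_self (hp3 x).le]

/-- Multiplication of Clifford-valued by real-valued continuous functions. -/
def smulMap : C(T, ℝ) →L[ℝ] C(T, Cl m) →L[ℝ] C(T, Cl m) :=
  LinearMap.mkContinuous₂
    (LinearMap.mk₂ ℝ (fun (p : C(T, ℝ)) (f : C(T, Cl m)) => p • f)
      (fun p q f => add_smul p q f) (fun c p f => by ext x; simp [mul_smul])
      (fun p f g => smul_add p f g)
      (fun c p f => by
        ext1 x
        simp [smul_smul, mul_comm])) 1 (by
    intro p f
    rw [one_mul, ContinuousMap.norm_le _ (by positivity)]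
    intro x
    simp only [LinearMap.mk₂_apply, ContinuousMap.smul_apply', norm_smul]
    exact mul_le_mul (p.norm_coe_le_norm x) (f.norm_coe_le_norm x) (norm_nonneg _) (norm_nonneg _))

@[simp] lemma smulMap_apply (p : C(T, ℝ)) (f : C(T, Cl m)) (x : T) :
    smulMap p f x = p x • f x := rfl

end superposition

/-- The closed unit ball. -/
abbrev K (m : ℕ) : Type := Metric.closedBall (0 : E m) 1

instance : CompactSpace (K m) := isCompact_iff_compactSpace.mp (isCompact_closedBall 0 1)

/-- The Banach space of continuous Clifford-valued functions on the closed unit ball. -/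
abbrev X (m : ℕ) : Type := C(K m, Cl m)

lemma norm_coe_le (x : K m) : ‖(x : E m)‖ ≤ 1 := mem_closedBall_zero_iff.mp x.2

/-- The function `x ↦ |1 - ȳ x|^2` on the closed ball. -/
def quadX (y : E m) : C(K m, ℝ) := ⟨fun x => quad y x, by unfold quad; fun_prop⟩

/-- The function `x ↦ conj (1 - ȳ x)` on the closed ball. -/
def numX (y : E m) : X m := ⟨fun x => (1 : Cl m) - (vec (x : E m)).conj * vec y,
  continuous_const.sub (((Cl.conjL.comp vecL).continuous.comp continuous_subtype_val).mul
    continuous_const)⟩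

/-- The Szegő kernel `S_y`, for `|y| < 1`, as a continuous function on the closed ball. -/
def szegoX (y : E m) : X m := smulMap (Ring.inverse (sqrtMap (quadX y)) ^ (m + 1)) (numX y)

lemma quad_pos_of_mem {y : E m} (hy : ‖y‖ < 1) (x : K m) : 0 < quad y x := by
  refine quad_pos ((mul_le_of_le_one_right (norm_nonneg _) (norm_coe_le x)).trans_lt hy)

lemma szegoX_apply {y : E m} (hy : ‖y‖ < 1) (x : K m) : szegoX y x = szego y x := by
  have hu : IsUnit (sqrtMap (quadX y)) := by
    rw [ContinuousMap.isUnit_iff_forall_ne_zero]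
    exact fun x => (Real.sqrt_pos.mpr (quad_pos_of_mem hy x)).ne'
  have h1 : Ring.inverse (sqrtMap (quadX y)) x = (Real.sqrt (quad y x))⁻¹ := by
    have := congrArg (fun f : C(K m, ℝ) => f x) (Ring.inverse_mul_cancel _ hu)
    exact eq_inv_of_mul_eq_one_left this
  rw [szegoX, smulMap_apply, ContinuousMap.pow_apply, h1, inv_pow, szego_eq]
  rfl

lemma contDiffAt_szegoX {n : WithTop ℕ∞} (hn : n ≠ 0) {y : E m} (hy : ‖y‖ < 1) :
    ContDiffAt ℝ n szegoX y := by
  let l₁ : E m →ₗ[ℝ] C(K m, ℝ) :=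
    { toFun := fun y => ⟨fun x => ⟪y, (x : E m)⟫, by fun_prop⟩
      map_add' := fun y z => by ext x; simp [inner_add_left]
      map_smul' := fun r y => by ext x; simp [inner_smul_left] }
  let l₂ : E m →ₗ[ℝ] X m :=
    { toFun := fun y => ⟨fun x => (vec (x : E m)).conj * vec y,
        ((Cl.conjL.comp vecL).continuous.comp continuous_subtype_val).mul continuous_const⟩
      map_add' := fun y z => by
        ext1 x
        change (vec (x : E m)).conj * vec (y + z)
          = (vec (x : E m)).conj * vec y + (vec (x : E m)).conj * vec z
        rw [vec_add, mul_add]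
      map_smul' := fun r y => by
        ext1 x
        change (vec (x : E m)).conj * vec (r • y) = r • ((vec (x : E m)).conj * vec y)
        rw [vec_smul, mul_smul_comm] }
  have h1 : ContDiff ℝ n l₁ := (LinearMap.toContinuousLinearMap l₁).contDiff
  have h2 : ContDiff ℝ n l₂ := (LinearMap.toContinuousLinearMap l₂).contDiff
  have hq : ContDiff ℝ n (quadX (m := m)) := by
    have : quadX (m := m) = fun y => (1 : C(K m, ℝ)) - (2 : ℝ) • l₁ y
        + ‖y‖ ^ 2 • (⟨fun x => ‖(x : E m)‖ ^ 2, by fun_prop⟩ : C(K m, ℝ)) := by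
      ext y x; rfl
    rw [this]
    exact (contDiff_const.sub (h1.const_smul _)).add ((contDiff_norm_sq ℝ).smul contDiff_const)
  have hnum : ContDiff ℝ n (numX (m := m)) := by
    have : numX (m := m) = fun y => (1 : X m) - l₂ y := by
      ext1 y; ext1 x; rfl
    rw [this]
    exact contDiff_const.sub h2
  have hs : ContDiffAt ℝ n (fun y => sqrtMap (quadX y)) y :=
    (contDiffAt_sqrtMap hn fun x => quad_pos_of_mem hy x).comp y hq.contDiffAt
  obtain ⟨u, hu⟩ : IsUnit (sqrtMap (quadX y)) := by
    rw [ContinuousMap.isUnit_iff_forall_ne_zero]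
    exact fun x => (Real.sqrt_pos.mpr (quad_pos_of_mem hy x)).ne'
  have hi : ContDiffAt ℝ n (fun y => Ring.inverse (sqrtMap (quadX y))) y := by
    refine ContDiffAt.comp y (g := Ring.inverse) ?_ hs
    rw [← hu]; exact contDiffAt_ringInverse ℝ u
  exact (smulMap.contDiff.contDiffAt.comp y (hi.pow _)).clm_apply hnum.contDiffAt

/-! ### The inner product -/

/-- The unit sphere inside the closed ball. -/
def sphK (η : Metric.sphere (0 : E m) 1) : K m := ⟨η, Metric.sphere_subset_closedBall η.2⟩

lemma continuous_sphK : Continuous (sphK (m := m)) := by unfold sphK; fun_prop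

lemma integrable_of_continuous {Y : Type*} [NormedAddCommGroup Y]
    {f : Metric.sphere (0 : E m) 1 → Y} (hf : Continuous f) : Integrable f (surf m) :=
  hf.integrable_of_hasCompactSupport (HasCompactSupport.of_compactSpace _)

lemma continuous_conj_mul (F G : X m) : Continuous fun η => (G (sphK η)).conj * F (sphK η) :=
  (Cl.conjL.continuous.comp (G.continuous.comp continuous_sphK)).mul
    (F.continuous.comp continuous_sphK)

/-- The Clifford-valued inner product `⟨F, G⟩` of two continuous functions on the closed ball, as a
real bilinear map. -/
def ip : X m →L[ℝ] X m →L[ℝ] Cl m :=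
  LinearMap.mkContinuous₂
    (LinearMap.mk₂ ℝ (fun F G : X m => ⨍ η, (G (sphK η)).conj * F (sphK η) ∂(surf m))
      (fun F F' G => by
        simp only [average_eq, ContinuousMap.add_apply, mul_add]
        rw [integral_add (integrable_of_continuous (continuous_conj_mul F G))
          (integrable_of_continuous (continuous_conj_mul F' G)), smul_add])
      (fun c F G => by
        simp only [average_eq, ContinuousMap.smul_apply, mul_smul_comm]
        rw [integral_smul, smul_comm])
      (fun F G G' => by
        simp only [average_eq, ContinuousMap.add_apply, Cl.conj_add, add_mul]
        rw [integral_add (integrable_of_continuous (continuous_conj_mul F G))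
          (integrable_of_continuous (continuous_conj_mul F G')), smul_add])
      (fun c F G => by
        simp only [average_eq, ContinuousMap.smul_apply, Cl.conj_smul, smul_mul_assoc]
        rw [integral_smul, smul_comm]))
    (‖(Cl.mulL : Cl m →L[ℝ] Cl m →L[ℝ] Cl m)‖ * ‖(Cl.conjL : Cl m →L[ℝ] Cl m)‖) (by
      intro F G
      simp only [LinearMap.mk₂_apply]
      have hpos : 0 < (surf m).real Set.univ := surf_real_univ_pos
      rw [average_eq, norm_smul, norm_inv, Real.norm_of_nonneg hpos.le, inv_mul_le_iff₀ hpos]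
      refine (norm_integral_le_of_norm_le_const (C := ‖(Cl.mulL : Cl m →L[ℝ] Cl m →L[ℝ] Cl m)‖ *
        ‖(Cl.conjL : Cl m →L[ℝ] Cl m)‖ * ‖F‖ * ‖G‖)
        (Eventually.of_forall fun η => ?_)).trans (le_of_eq (mul_comm _ _))
      calc ‖(G (sphK η)).conj * F (sphK η)‖
          ≤ ‖(Cl.mulL : Cl m →L[ℝ] Cl m →L[ℝ] Cl m)‖ * ‖(G (sphK η)).conj‖ * ‖F (sphK η)‖ :=
            Cl.mulL.le_opNorm₂ _ _
        _ ≤ ‖(Cl.mulL : Cl m →L[ℝ] Cl m →L[ℝ] Cl m)‖ *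
              (‖(Cl.conjL : Cl m →L[ℝ] Cl m)‖ * ‖G‖) * ‖F‖ := by
            gcongr
            · exact (Cl.conjL.le_opNorm _).trans (by gcongr; exact G.norm_coe_le_norm _)
            · exact F.norm_coe_le_norm _
        _ = _ := by ring)

lemma ip_apply (F G : X m) : ip F G = ⨍ η, (G (sphK η)).conj * F (sphK η) ∂(surf m) := rfl

/-- Right multiplication by a Clifford number. -/
def rmul (c : Cl m) (F : X m) : X m := F * ContinuousMap.const _ c

@[simp] lemma rmul_apply (c : Cl m) (F : X m) (x : K m) : rmul c F x = F x * c := rfl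

lemma ip_rmul_left (c : Cl m) (F G : X m) : ip (rmul c F) G = ip F G * c := by
  simp only [ip_apply, rmul_apply, average_eq, ← mul_assoc, smul_mul_assoc]
  congr 1
  exact (Cl.mulL.flip c).integral_comp_comm (integrable_of_continuous (continuous_conj_mul F G))

lemma ip_rmul_right (c : Cl m) (F G : X m) : ip F (rmul c G) = c.conj * ip F G := by
  simp only [ip_apply, rmul_apply, average_eq, Cl.conj_mul, mul_assoc, mul_smul_comm]
  congr 1
  exact (Cl.mulL c.conj).integral_comp_comm (integrable_of_continuous (continuous_conj_mul F G))

lemma conj_ip (F G : X m) : (ip F G).conj = ip G F := by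
  simp only [ip_apply, average_eq, Cl.conj_smul]
  congr 1
  have := Cl.conjL.integral_comp_comm (integrable_of_continuous (continuous_conj_mul F G))
  simp only [Cl.conjL_apply, Cl.conj_mul, Cl.conj_conj] at this
  exact this.symm

instance : (surf m).IsOpenPosMeasure where
  open_pos U hU hne := by
    obtain ⟨x, hx⟩ := hne
    obtain ⟨ε, hε, hsub⟩ := Metric.isOpen_iff.mp hU x hx
    have h1 := (volume : Measure (E m)).toSphereBallBound_mul_measure_unitBall_le_toSphere_ball hε x
    have h2 : 0 < (volume : Measure (E m)).toSphere (Metric.ball x ε) := by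
      refine lt_of_lt_of_le (ENNReal.mul_pos ?_ ?_) h1
      · simpa using (Measure.toSphereBallBound_pos _ ε).ne'
      · exact (Metric.measure_ball_pos volume _ one_pos).ne'
    exact (h2.trans_le (measure_mono hsub)).ne'

lemma re_ip (F G : X m) : Cl.re (ip F G) = ⨍ η, ⟪G (sphK η), F (sphK η)⟫ ∂(surf m) := by
  rw [ip_apply, average_eq, average_eq, map_smul,
    ← Cl.re.integral_comp_comm (integrable_of_continuous (continuous_conj_mul F G))]
  simp_rw [Cl.re_conj_mul]

lemma eq_zero_on_sphere {F : X m} (h : Cl.re (ip F F) = 0) (η : Metric.sphere (0 : E m) 1) :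
    F (sphK η) = 0 := by
  have hc : Continuous fun η => ‖F (sphK η)‖ ^ 2 := by
    have := F.continuous.comp (continuous_sphK (m := m))
    exact (this.norm).pow 2
  rw [re_ip, average_eq, smul_eq_mul, mul_eq_zero_iff_left
    (inv_ne_zero surf_real_univ_pos.ne')] at h
  simp_rw [real_inner_self_eq_norm_sq] at h
  rw [integral_eq_zero_iff_of_nonneg (fun _ => by positivity) (integrable_of_continuous hc),
    hc.ae_eq_iff_eq _ continuous_zero] at h
  simpa using congrFun h η

/-! ### The reproducing subspace -/

/-- The continuous functions on the closed ball that are reproduced by the Szegő kernel. -/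
def X0 (m : ℕ) : Submodule ℝ (X m) where
  carrier := {F | ∀ a : K m, ‖(a : E m)‖ < 1 → F a = ip F (szegoX a)}
  add_mem' := fun hF hG a ha => by simp [hF a ha, hG a ha]
  zero_mem' := fun a _ => by simp
  smul_mem' := fun c F hF a ha => by simp [hF a ha]

lemma rmul_mem_X0 {F : X m} (hF : F ∈ X0 m) (c : Cl m) : rmul c F ∈ X0 m := fun a ha => by
  rw [ip_rmul_left, rmul_apply, hF a ha]

/-- A reproduced function is determined by its values on the sphere, so `⟨·, ·⟩` is definite. -/
lemma eq_zero_of_re_ip_self {F : X m} (hF : F ∈ X0 m) (h : Cl.re (ip F F) = 0) : F = 0 := by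
  have hs := eq_zero_on_sphere h
  ext1 x
  rcases (norm_coe_le x).lt_or_eq with hx | hx
  · rw [hF x hx, ip_apply, average_eq]
    simp [hs]
  · exact hs ⟨x, mem_sphere_zero_iff_norm.mpr hx⟩

/-- `F` is the continuous extension of `f` to the closed ball. -/
def Rep (f : E m → Cl m) (F : X m) : Prop := ∀ x : K m, ‖(x : E m)‖ < 1 → f x = F x

/-- A point of the open ball as a point of the closed ball. -/
def mkK (x : E m) (hx : ‖x‖ < 1) : K m := ⟨x, mem_closedBall_zero_iff.mpr hx.le⟩

lemma Rep.eq {f : E m → Cl m} {F : X m} (hf : Rep f F) {x : E m} (hx : ‖x‖ < 1) :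
    f x = F (mkK x hx) := hf (mkK x hx) hx

/-- The restriction of a function to the closed ball. -/
def restr (f : E m → Cl m) (hf : ContinuousOn f (Metric.closedBall 0 1)) : X m :=
  ⟨fun x => f x, hf.comp_continuous continuous_subtype_val fun x => x.2⟩

lemma restr_mem_X0 {R : ℝ} (hR : 1 < R) {f : E m → Cl m}
    (hf : ContDiffOn ℝ 1 f (Metric.ball 0 R))
    (hD : ∀ x ∈ Metric.ball (0 : E m) R,
      ∑ i : Fin (m + 1), eVec i * fderiv ℝ f x (EuclideanSpace.single i 1) = 0)
    (hc : ContinuousOn f (Metric.closedBall 0 1)) : restr f hc ∈ X0 m := by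
  intro a ha
  rw [ip_apply]
  change f a = _
  rw [cauchy_formula hR hf hD ha]
  simp_rw [szegoX_apply ha]
  rfl

lemma szegoX_mem_X0 {b : E m} (hb : ‖b‖ < 1) : szegoX b ∈ X0 m := by
  set R := 2 / (1 + ‖b‖) with hRdef
  have hb0 := norm_nonneg b
  have hR : 1 < R := by rw [hRdef, lt_div_iff₀ (by linarith)]; linarith
  have hq : ∀ x ∈ Metric.ball (0 : E m) R, 0 < quad b x := by
    intro x hx
    rw [mem_ball_zero_iff, hRdef, lt_div_iff₀ (by linarith)] at hx
    exact quad_pos (by nlinarith [norm_nonneg x])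
  have hf : ContDiffOn ℝ 1 (szego b) (Metric.ball 0 R) := fun x hx =>
    (contDiffAt_szego (hq x hx)).contDiffWithinAt
  have := restr_mem_X0 hR hf (fun x hx => by
    obtain ⟨S', hS, h0⟩ := hasFDerivAt_szego (hq x hx)
    rw [hS.fderiv, h0]) (hf.continuousOn.mono (Metric.closedBall_subset_ball hR))
  convert this using 1
  ext1 x
  exact szegoX_apply hb x

/-! ### Derivatives of the kernel in its parameter -/

lemma iteratedDeriv_clm_comp {Y Z : Type*} [NormedAddCommGroup Y] [NormedSpace ℝ Y]
    [NormedAddCommGroup Z] [NormedSpace ℝ Z] (L : Y →L[ℝ] Z) {γ : ℝ → Y} {t : ℝ} (k : ℕ)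
    (hγ : ContDiffAt ℝ k γ t) :
    iteratedDeriv k (fun s => L (γ s)) t = L (iteratedDeriv k γ t) := by
  have := L.iteratedFDeriv_comp_left hγ (i := k) le_rfl
  rw [iteratedDeriv, iteratedDeriv]
  change iteratedFDeriv ℝ k (L ∘ γ) t _ = _
  rw [this]; rfl

/-- The higher order Szegő kernel `∂_v^k S_y |_{y = a}` as a function on the closed ball. -/
def szegoDerivX (k : ℕ) (v a : E m) : X m := iteratedDeriv k (fun t : ℝ => szegoX (a + t • v)) 0

variable {a v : E m}

lemma eventually_norm_lt (ha : ‖a‖ < 1) (v : E m) : ∀ᶠ t : ℝ in 𝓝 0, ‖a + t • v‖ < 1 := by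
  have : ContinuousAt (fun t : ℝ => ‖a + t • v‖) 0 := by fun_prop
  exact this.eventually_lt continuousAt_const (by simpa using ha)

lemma contDiffAt_szegoX_line {n : WithTop ℕ∞} (ha : ‖a‖ < 1) (v : E m) :
    ContDiffAt ℝ n (fun t : ℝ => szegoX (a + t • v)) 0 := by
  have h : ContDiffAt ℝ ⊤ (szegoX (m := m)) (a + (0 : ℝ) • v) :=
    contDiffAt_szegoX (by simp) (by simpa using ha)
  have h2 : ContDiffAt ℝ ⊤ (fun t : ℝ => a + t • v) 0 := by fun_prop
  exact (h.comp (0 : ℝ) h2).of_le le_top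

lemma szegoDerivX_apply (ha : ‖a‖ < 1) (k : ℕ) (x : K m) :
    szegoDeriv k v a x = szegoDerivX k v a x := by
  have h := iteratedDeriv_clm_comp (ContinuousMap.evalCLM ℝ x) k (contDiffAt_szegoX_line ha v)
  refine Eq.trans ?_ h
  refine Filter.EventuallyEq.iteratedDeriv_eq k ?_
  filter_upwards [eventually_norm_lt ha v] with t ht
  exact (szegoX_apply ht x).symm

lemma rep_szegoDeriv (ha : ‖a‖ < 1) (k : ℕ) (v : E m) :
    Rep (szegoDeriv k v a) (szegoDerivX k v a) := fun x _ => szegoDerivX_apply ha k x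

lemma szegoDeriv_zero (v a : E m) : szegoDeriv 0 v a = szego a := by
  ext1 x; simp [szegoDeriv, dirDeriv]

lemma rep_szego (ha : ‖a‖ < 1) : Rep (szego a) (szegoX a) := fun x _ => (szegoX_apply ha x).symm

lemma szegoDerivX_mem_X0 (ha : ‖a‖ < 1) (k : ℕ) (v : E m) : szegoDerivX k v a ∈ X0 m := by
  intro b hb
  let L : X m →L[ℝ] Cl m := ContinuousMap.evalCLM ℝ b - ip.flip (szegoX b)
  have h := iteratedDeriv_clm_comp L k (contDiffAt_szegoX_line ha v)
  have h2 : (fun t : ℝ => L (szegoX (a + t • v))) =ᶠ[𝓝 0] fun _ => 0 := by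
    filter_upwards [eventually_norm_lt ha v] with t ht
    exact sub_eq_zero.mpr (szegoX_mem_X0 ht b hb)
  rw [h2.iteratedDeriv_eq k, iteratedDeriv_const] at h
  have h3 : L (szegoDerivX k v a) = 0 := by
    rw [szegoDerivX, ← h]; simp
  exact sub_eq_zero.mp h3

/-- Derivatives of a reproduced function are inner products with the derivatives of the kernel. -/
lemma dirDeriv_eq_ip {f : E m → Cl m} {F : X m} (hF : F ∈ X0 m) (hf : Rep f F) (ha : ‖a‖ < 1)
    (k : ℕ) (v : E m) : dirDeriv k v f a = ip F (szegoDerivX k v a) := by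
  rw [szegoDerivX, ← iteratedDeriv_clm_comp (ip F) k (contDiffAt_szegoX_line ha v)]
  refine Filter.EventuallyEq.iteratedDeriv_eq k ?_
  filter_upwards [eventually_norm_lt ha v] with t ht
  exact (hf.eq ht).trans (hF (mkK _ ht) ht)

lemma eq_ip_szegoX {f : E m → Cl m} {F : X m} (hF : F ∈ X0 m) (hf : Rep f F) {y : E m}
    (hy : ‖y‖ < 1) : f y = ip F (szegoX y) := (hf.eq hy).trans (hF (mkK y hy) hy)

/-- Reproduced functions are left monogenic, since `y ↦ conj (S_y(x)) = S_x(y)` is. -/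
lemma leftMonogenic_of_mem_X0 {f : E m → Cl m} {F : X m} (hF : F ∈ X0 m) (hf : Rep f F) :
    LeftMonogenic f := by
  have hball : ∀ y ∈ B1 m, ‖y‖ < 1 := fun y hy => mem_ball_zero_iff.mp hy
  refine ⟨?_, fun y hy => ?_⟩
  · have : ContDiffOn ℝ 1 (fun y => ip F (szegoX y)) (B1 m) := fun y hy =>
      ((ip F).contDiff.contDiffAt.comp y
        (contDiffAt_szegoX one_ne_zero (hball y hy))).contDiffWithinAt
    exact this.congr fun y hy => eq_ip_szegoX hF hf (hball y hy)
  · have hy' := hball y hy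
    have hS : HasFDerivAt szegoX (fderiv ℝ szegoX y) y :=
      ((contDiffAt_szegoX one_ne_zero hy').differentiableAt one_ne_zero).hasFDerivAt
    have hfd : HasFDerivAt f ((ip F).comp (fderiv ℝ szegoX y)) y := by
      refine ((ip F).hasFDerivAt.comp y hS).congr_of_eventuallyEq ?_
      filter_upwards [Metric.isOpen_ball.mem_nhds hy] with z hz
      exact eq_ip_szegoX hF hf (hball z hz)
    have hterm : ∀ i : Fin (m + 1), eVec i * fderiv ℝ f y (EuclideanSpace.single i 1)
        = ip F (rmul (eVec i).conj (fderiv ℝ szegoX y (EuclideanSpace.single i 1))) := by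
      intro i
      rw [hfd.fderiv, ip_rmul_right, Cl.conj_conj]; rfl
    simp_rw [hterm]
    rw [← map_sum]
    convert map_zero (ip F)
    ext1 x
    -- pointwise, `S_y(x)` is the conjugate of `S_x(y)`, which is left monogenic in `y`
    have hq : 0 < quad (x : E m) y := quad_comm y (x : E m) ▸ quad_pos_of_mem hy' x
    obtain ⟨S', hS', h0⟩ := hasFDerivAt_szego hq
    have hx1 : HasFDerivAt (fun z => szegoX z x)
        ((ContinuousMap.evalCLM ℝ x : X m →L[ℝ] Cl m).comp (fderiv ℝ szegoX y)) y :=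
      (ContinuousMap.evalCLM ℝ x : X m →L[ℝ] Cl m).hasFDerivAt.comp y hS
    have hx2 : HasFDerivAt (fun z => szegoX z x) (Cl.conjL.comp S') y := by
      refine (Cl.conjL.hasFDerivAt.comp y hS').congr_of_eventuallyEq ?_
      filter_upwards [Metric.isOpen_ball.mem_nhds hy] with z hz
      rw [szegoX_apply (hball z hz), ← conj_szego]; rfl
    have hx3 : ∀ w, (fderiv ℝ szegoX y w) x = (S' w).conj := fun w =>
      DFunLike.congr_fun (hx1.unique hx2) w
    simp only [ContinuousMap.sum_apply, rmul_apply, hx3, ← Cl.conj_mul, ← Cl.conj_sum, h0,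
      Cl.conj_zero, ContinuousMap.zero_apply]

/-! ### Boundary values and the Hardy norm -/

/-- Extension of a function on the closed ball by zero. -/
def ext (F : X m) : E m → Cl m := Function.extend Subtype.val F 0

lemma ext_apply (F : X m) (x : K m) : ext F x = F x := Subtype.val_injective.extend_apply F 0 x

lemma rep_ext (F : X m) : Rep (ext F) F := fun x _ => ext_apply F x

lemma rep_iff {f : E m → Cl m} {F : X m} : Rep f F ↔ Set.EqOn f (ext F) (B1 m) := by
  constructor
  · intro h x hx
    have hx' : ‖x‖ < 1 := mem_ball_zero_iff.mp hx
    exact (h.eq hx').trans (ext_apply F (mkK x hx')).symm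
  · intro h x hx
    rw [h (mem_ball_zero_iff.mpr hx), ext_apply]

lemma continuousOn_ext (F : X m) : ContinuousOn (ext F) (Metric.closedBall 0 1) := by
  rw [continuousOn_iff_continuous_domRestrict]
  have : (Metric.closedBall (0 : E m) 1).domRestrict (ext F) = F := funext fun x => ext_apply F x
  rw [this]; exact F.continuous

lemma continuousOn_of_rep {f : E m → Cl m} {F : X m} (hf : Rep f F) : ContinuousOn f (B1 m) :=
  ((continuousOn_ext F).mono Metric.ball_subset_closedBall).congr (rep_iff.mp hf)

lemma boundary_eq {f : E m → Cl m} {F : X m} (hf : Rep f F) (η : Metric.sphere (0 : E m) 1) :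
    boundary f (η : E m) = F (sphK η) := by
  have hη : ‖(η : E m)‖ = 1 := norm_eq_of_mem_sphere η
  have hne : (nontangential (η : E m)).NeBot := by
    have h1 : Tendsto (fun t : ℝ => (1 - t) • (η : E m)) (𝓝[>] 0) (𝓝 (η : E m)) := by
      have : ContinuousAt (fun t : ℝ => (1 - t) • (η : E m)) 0 := by fun_prop
      have h2 := this.tendsto.mono_left (nhdsWithin_le_nhds (s := Set.Ioi 0))
      simpa using h2
    have h2 : Tendsto (fun t : ℝ => (1 - t) • (η : E m)) (𝓝[>] 0)
        (𝓝[{x : E m | ‖x‖ < 1 ∧ ‖x - (η : E m)‖ < 2 * (1 - ‖x‖)}] (η : E m)) := by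
      refine tendsto_nhdsWithin_iff.mpr ⟨h1, ?_⟩
      filter_upwards [Ioo_mem_nhdsGT (one_pos (α := ℝ))] with t ht
      have e1 : ‖(1 - t) • (η : E m)‖ = 1 - t := by
        rw [norm_smul, hη, mul_one, Real.norm_of_nonneg (by linarith [ht.2])]
      have e2 : ‖(1 - t) • (η : E m) - (η : E m)‖ = t := by
        rw [sub_smul, one_smul, sub_sub_cancel_left, norm_neg, norm_smul, hη, mul_one,
          Real.norm_of_nonneg ht.1.le]
      change ‖_‖ < 1 ∧ ‖_ - _‖ < 2 * (1 - ‖_‖)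
      rw [e1, e2]
      constructor <;> linarith [ht.1]
    exact (h2.neBot).mono (le_iSup (fun α : ℝ => 𝓝[{x : E m | ‖x‖ < 1 ∧
      ‖x - (η : E m)‖ < α * (1 - ‖x‖)}] (η : E m)) 2)
  have hlim : Tendsto f (nontangential (η : E m)) (𝓝 (F (sphK η))) := by
    refine tendsto_iSup.mpr fun α => ?_
    have h1 : Tendsto f (𝓝[Metric.ball 0 1] (η : E m)) (𝓝 (F (sphK η))) := by
      have h2 : ContinuousWithinAt (ext F) (Metric.closedBall 0 1) (η : E m) :=
        continuousOn_ext F _ (sphK η).2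
      have h3 := h2.tendsto
      rw [show ext F (η : E m) = F (sphK η) from ext_apply F (sphK η)] at h3
      refine (h3.mono_left (nhdsWithin_mono _ Metric.ball_subset_closedBall)).congr' ?_
      filter_upwards [self_mem_nhdsWithin] with x hx
      have hx' : ‖x‖ < 1 := mem_ball_zero_iff.mp hx
      exact (ext_apply F (mkK x hx')).trans (hf.eq hx').symm
    exact h1.mono_left (nhdsWithin_mono _ fun x hx => mem_ball_zero_iff.mpr hx.1)
  have := hne
  exact hlim.limUnder_eq

lemma hardyInner_eq {f g : E m → Cl m} {F G : X m} (hf : Rep f F) (hg : Rep g G) :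
    hardyInner f g = ip F G := by
  rw [hardyInner, ip_apply]
  simp_rw [boundary_eq hf, boundary_eq hg]

section L2

lemma norm_toLp_eq {u : Metric.sphere (0 : E m) 1 → Cl m} (hu : MemLp u 2 (surf m)) :
    ‖hu.toLp u‖ = Real.sqrt (∫ η, ‖u η‖ ^ 2 ∂(surf m)) := by
  rw [← Real.sqrt_sq (norm_nonneg (hu.toLp u)), ← real_inner_self_eq_norm_sq, L2.inner_def]
  congr 1
  refine integral_congr_ae ?_
  filter_upwards [hu.coeFn_toLp] with η hη
  rw [hη, real_inner_self_eq_norm_sq]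

lemma memLp_of_continuous {u : Metric.sphere (0 : E m) 1 → Cl m} (hu : Continuous u) :
    MemLp u 2 (surf m) :=
  hu.memLp_of_hasCompactSupport (HasCompactSupport.of_compactSpace _)

lemma continuous_dilate {f : E m → Cl m} (hf : ContinuousOn f (B1 m)) {r : ℝ}
    (hr : r ∈ Set.Ioo (0 : ℝ) 1) :
    Continuous fun η : Metric.sphere (0 : E m) 1 => f (r • (η : E m)) := by
  refine hf.comp_continuous (by fun_prop) fun η => mem_ball_zero_iff.mpr ?_
  rw [norm_smul, norm_eq_of_mem_sphere, mul_one, Real.norm_of_nonneg hr.1.le]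
  exact hr.2

lemma sphereMean_eq {f : E m → Cl m} (hf : ContinuousOn f (B1 m)) {r : ℝ}
    (hr : r ∈ Set.Ioo (0 : ℝ) 1) : sphereMean f r = Real.sqrt ((surf m).real Set.univ)⁻¹ *
      ‖(memLp_of_continuous (continuous_dilate hf hr)).toLp _‖ := by
  rw [norm_toLp_eq, sphereMean, average_eq, smul_eq_mul, Real.sqrt_mul (by positivity)]

lemma sphereMean_add_le {f g : E m → Cl m} (hf : ContinuousOn f (B1 m))
    (hg : ContinuousOn g (B1 m)) {r : ℝ} (hr : r ∈ Set.Ioo (0 : ℝ) 1) :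
    sphereMean (fun x => f x + g x) r ≤ sphereMean f r + sphereMean g r := by
  rw [sphereMean_eq hf hr, sphereMean_eq hg hr,
    sphereMean_eq (f := fun x => f x + g x) (hf.add hg) hr, ← mul_add]
  refine mul_le_mul_of_nonneg_left ?_ (Real.sqrt_nonneg _)
  exact norm_add_le ((memLp_of_continuous (continuous_dilate hf hr)).toLp _)
    ((memLp_of_continuous (continuous_dilate hg hr)).toLp _)

lemma sphereMean_nonneg (f : E m → Cl m) (r : ℝ) : 0 ≤ sphereMean f r := Real.sqrt_nonneg _

lemma sphereMean_smul (c : ℝ) (f : E m → Cl m) (r : ℝ) :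
    sphereMean (fun x => c • f x) r = |c| * sphereMean f r := by
  simp only [sphereMean, norm_smul, mul_pow, average_eq, smul_eq_mul]
  rw [integral_const_mul, mul_left_comm, Real.sqrt_mul (by positivity), Real.norm_eq_abs, sq_abs,
    Real.sqrt_sq_eq_abs]

lemma eq_zero_of_sphereMean {f : E m → Cl m} (hf : ContinuousOn f (B1 m)) {r : ℝ}
    (hr : r ∈ Set.Ioo (0 : ℝ) 1) (h : sphereMean f r = 0) (η : Metric.sphere (0 : E m) 1) :
    f (r • (η : E m)) = 0 := by
  have hc := continuous_dilate hf hr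
  have hc2 : Continuous fun η : Metric.sphere (0 : E m) 1 => ‖f (r • (η : E m))‖ ^ 2 :=
    hc.norm.pow 2
  rw [sphereMean, Real.sqrt_eq_zero (by rw [average_eq]; positivity), average_eq, smul_eq_mul,
    mul_eq_zero_iff_left (inv_ne_zero surf_real_univ_pos.ne'),
    integral_eq_zero_iff_of_nonneg (fun _ => by positivity) (integrable_of_continuous hc2),
    hc2.ae_eq_iff_eq _ continuous_zero] at h
  simpa using congrFun h η

lemma smul_sphere_mem {r : ℝ} (hr : r ∈ Set.Ioo (0 : ℝ) 1) (η : Metric.sphere (0 : E m) 1) :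
    ‖r • (η : E m)‖ < 1 := by
  rw [norm_smul, norm_eq_of_mem_sphere, mul_one, Real.norm_of_nonneg hr.1.le]
  exact hr.2

lemma sphereMean_le {f : E m → Cl m} {F : X m} (hf : Rep f F) {r : ℝ}
    (hr : r ∈ Set.Ioo (0 : ℝ) 1) : sphereMean f r ≤ ‖F‖ := by
  refine Real.sqrt_le_iff.mpr ⟨norm_nonneg _, ?_⟩
  rw [average_eq, smul_eq_mul, inv_mul_le_iff₀ surf_real_univ_pos, mul_comm]
  refine (le_abs_self _).trans ?_
  rw [← Real.norm_eq_abs]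
  refine norm_integral_le_of_norm_le_const (Eventually.of_forall fun η => ?_)
  rw [norm_pow, norm_norm]
  have h1 := smul_sphere_mem hr η
  rw [hf.eq h1]
  gcongr
  exact F.norm_coe_le_norm _

lemma sphereMean_congr {f g : E m → Cl m} (h : Set.EqOn f g (B1 m)) {r : ℝ}
    (hr : r ∈ Set.Ioo (0 : ℝ) 1) : sphereMean f r = sphereMean g r := by
  simp only [sphereMean]
  congr 2
  ext η
  rw [h (mem_ball_zero_iff.mpr (smul_sphere_mem hr η))]

lemma hardyNorm_congr {f g : E m → Cl m} (h : Set.EqOn f g (B1 m)) : hardyNorm f = hardyNorm g := by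
  rw [hardyNorm, hardyNorm, Set.image_congr fun r hr => sphereMean_congr h hr]

lemma bddAbove_of_rep {f : E m → Cl m} {F : X m} (hf : Rep f F) :
    BddAbove (sphereMean f '' Set.Ioo 0 1) := by
  refine ⟨‖F‖, ?_⟩
  rintro _ ⟨r, hr, rfl⟩
  exact sphereMean_le hf hr

lemma sphereMean_le_hardyNorm {f : E m → Cl m} (hf : BddAbove (sphereMean f '' Set.Ioo 0 1))
    {r : ℝ} (hr : r ∈ Set.Ioo (0 : ℝ) 1) : sphereMean f r ≤ hardyNorm f :=
  le_csSup hf ⟨r, hr, rfl⟩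

lemma hardyNorm_le {f : E m → Cl m} {C : ℝ} (h : ∀ r ∈ Set.Ioo (0 : ℝ) 1, sphereMean f r ≤ C) :
    hardyNorm f ≤ C := by
  refine csSup_le ⟨_, ⟨1 / 2, by norm_num, rfl⟩⟩ ?_
  rintro _ ⟨r, hr, rfl⟩
  exact h r hr

lemma hardyNorm_nonneg (f : E m → Cl m) : 0 ≤ hardyNorm f := by
  refine Real.sSup_nonneg ?_
  rintro _ ⟨r, _, rfl⟩
  exact sphereMean_nonneg f r

lemma hardyNorm_smul (c : ℝ) (f : E m → Cl m) :
    hardyNorm (fun x => c • f x) = |c| * hardyNorm f := by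
  rw [hardyNorm, hardyNorm, ← smul_eq_mul, ← Real.sSup_smul_of_nonneg (abs_nonneg c)]
  congr 1
  ext t
  simp only [Set.mem_image, Set.mem_smul_set, sphereMean_smul, smul_eq_mul]
  constructor
  · rintro ⟨r, hr, rfl⟩; exact ⟨_, ⟨r, hr, rfl⟩, rfl⟩
  · rintro ⟨_, ⟨r, hr, rfl⟩, rfl⟩; exact ⟨r, hr, rfl⟩

lemma memHardy_of_rep {f : E m → Cl m} {F : X m} (hF : F ∈ X0 m) (hf : Rep f F) : MemHardy f :=
  ⟨leftMonogenic_of_mem_X0 hF hf, bddAbove_of_rep hf⟩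

end L2

/-- The Hardy norm on the continuous functions on the closed ball. -/
def hN (F : X m) : ℝ := hardyNorm (ext F)

lemma hardyNorm_eq_hN {f : E m → Cl m} {F : X m} (hf : Rep f F) : hardyNorm f = hN F :=
  hardyNorm_congr (rep_iff.mp hf)

lemma hN_le_norm (F : X m) : hN F ≤ ‖F‖ := hardyNorm_le fun _ hr => sphereMean_le (rep_ext F) hr

lemma hN_smul (c : ℝ) (F : X m) : hN (c • F) = |c| * hN F := by
  rw [hN, hN, ← hardyNorm_smul]
  refine hardyNorm_congr fun x hx => ?_
  have hx' := Metric.ball_subset_closedBall hx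
  have h1 := ext_apply (c • F) ⟨x, hx'⟩
  have h2 := ext_apply F ⟨x, hx'⟩
  simp only at h1 h2
  rw [h1, h2]; rfl

lemma hN_add_le (F G : X m) : hN (F + G) ≤ hN F + hN G := by
  refine hardyNorm_le fun r hr => ?_
  have h : Set.EqOn (ext (F + G)) (fun x => ext F x + ext G x) (B1 m) := fun x hx => by
    have hx' := Metric.ball_subset_closedBall hx
    have h1 := ext_apply (F + G) ⟨x, hx'⟩
    have h2 := ext_apply F ⟨x, hx'⟩
    have h3 := ext_apply G ⟨x, hx'⟩
    simp only at h1 h2 h3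
    simp only [h1, h2, h3]; rfl
  rw [sphereMean_congr h hr]
  refine (sphereMean_add_le (continuousOn_of_rep (rep_ext F)) (continuousOn_of_rep (rep_ext G))
    hr).trans ?_
  exact add_le_add (sphereMean_le_hardyNorm (bddAbove_of_rep (rep_ext F)) hr)
    (sphereMean_le_hardyNorm (bddAbove_of_rep (rep_ext G)) hr)

lemma continuous_hN : Continuous (hN (m := m)) := by
  refine continuous_iff_continuousAt.mpr fun F => ?_
  refine tendsto_iff_dist_tendsto_zero.mpr ?_
  refine squeeze_zero (fun _ => dist_nonneg) (fun G => ?_)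
    (tendsto_iff_norm_sub_tendsto_zero.mp (tendsto_id (α := X m)))
  rw [Real.dist_eq, abs_le]
  have h1 := hN_add_le G (F - G)
  have h2 := hN_add_le F (G - F)
  have h3 := hN_le_norm (F - G)
  have h4 := hN_le_norm (G - F)
  rw [add_sub_cancel] at h1 h2
  rw [norm_sub_rev] at h3
  simp only [id]
  constructor <;> linarith

/-- Functions that are continuous on the open ball and vanish on all small spheres vanish. -/
lemma eqOn_zero_of_sphereMean {f : E m → Cl m} (hf : ContinuousOn f (B1 m))
    (h : ∀ r ∈ Set.Ioo (0 : ℝ) 1, sphereMean f r = 0) : Set.EqOn f 0 (B1 m) := by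
  have h1 : Set.EqOn f 0 (B1 m ∩ {0}ᶜ) := by
    rintro x ⟨hx, hx0⟩
    have hn : 0 < ‖x‖ := norm_pos_iff.mpr hx0
    have hη : ‖x‖⁻¹ • x ∈ Metric.sphere (0 : E m) 1 := by
      rw [mem_sphere_zero_iff_norm, norm_smul, norm_inv, norm_norm, inv_mul_cancel₀ hn.ne']
    have hr : ‖x‖ ∈ Set.Ioo (0 : ℝ) 1 := ⟨hn, mem_ball_zero_iff.mp hx⟩
    have := eq_zero_of_sphereMean hf hr (h _ hr) ⟨_, hη⟩
    rwa [smul_smul, mul_inv_cancel₀ hn.ne', one_smul] at this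
  refine h1.of_subset_closure hf continuousOn_const Set.inter_subset_left ?_
  exact Dense.open_subset_closure_inter (dense_compl_singleton (0 : E m)) Metric.isOpen_ball

lemma eq_zero_of_rep_zero {F : X m} (h : Set.EqOn (ext F) 0 (B1 m)) : F = 0 := by
  have h2 : Set.EqOn (ext F) 0 (Metric.closedBall 0 1) :=
    h.of_subset_closure (continuousOn_ext F) continuousOn_const Metric.ball_subset_closedBall
      (closure_ball (0 : E m) one_ne_zero).ge
  ext1 x
  rw [← ext_apply F x]; exact h2 x.2

lemma eq_zero_of_hN {F : X m} (h : hN F = 0) : F = 0 := by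
  refine eq_zero_of_rep_zero (eqOn_zero_of_sphereMean (continuousOn_of_rep (rep_ext F)) ?_)
  intro r hr
  exact le_antisymm (h ▸ sphereMean_le_hardyNorm (bddAbove_of_rep (rep_ext F)) hr)
    (sphereMean_nonneg _ _)

/-! ### Orthogonal projection onto right modules and the Gram–Schmidt remainder -/

/-- Orthogonal projection onto a finite-dimensional subspace on which a continuous bilinear form is
definite. -/
lemma exists_projection_of_definite {Y : Type*} [NormedAddCommGroup Y] [NormedSpace ℝ Y]
    (β : Y →L[ℝ] Y →L[ℝ] ℝ) (V : Submodule ℝ Y) [FiniteDimensional ℝ V]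
    (hV : ∀ v ∈ V, β v v = 0 → v = 0) :
    ∃ P : Y →L[ℝ] Y, (∀ F, P F ∈ V) ∧ ∀ F, ∀ v ∈ V, β (F - P F) v = 0 := by
  let w := Module.finBasis ℝ V
  let D : Y →L[ℝ] (Fin (Module.finrank ℝ V) → ℝ) :=
    ContinuousLinearMap.pi fun k => β.flip (w k : Y)
  have hD : ∀ F k, D F k = β F (w k) := fun F k => rfl
  have hext : ∀ F, D F = 0 → ∀ v ∈ V, β F v = 0 := by
    intro F hF v hv
    have h0 : (β F).toLinearMap ∘ₗ V.subtype = 0 := w.ext fun k => congrFun hF k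
    exact DFunLike.congr_fun h0 ⟨v, hv⟩
  let J : V →ₗ[ℝ] (Fin (Module.finrank ℝ V) → ℝ) := D.toLinearMap ∘ₗ V.subtype
  have hJ : Function.Injective J := by
    rw [← LinearMap.ker_eq_bot, LinearMap.ker_eq_bot']
    intro v hv
    exact Subtype.ext (hV v v.2 (hext v hv v v.2))
  let e := LinearEquiv.ofInjectiveOfFinrankEq J hJ (by simp)
  let Q : (Fin (Module.finrank ℝ V) → ℝ) →L[ℝ] V :=
    LinearMap.toContinuousLinearMap e.symm.toLinearMap
  refine ⟨V.subtypeL.comp (Q.comp D), fun F => (Q (D F)).2, fun F => hext _ ?_⟩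
  have h1 : D (Q (D F) : Y) = D F := e.apply_symm_apply _
  rw [map_sub]
  exact sub_eq_zero.mpr h1.symm

/-- Real orthogonal projection onto a finite-dimensional space of reproduced functions. -/
lemma exists_orthogonal_projection (V : Submodule ℝ (X m)) [FiniteDimensional ℝ V]
    (hV : V ≤ X0 m) : ∃ P : X m →L[ℝ] X m, (∀ F, P F ∈ V) ∧
      ∀ F, ∀ v ∈ V, Cl.re (ip (F - P F) v) = 0 :=
  exists_projection_of_definite ((ContinuousLinearMap.compL ℝ (X m) (Cl m) ℝ Cl.re).comp ip) V
    fun _ hv h => eq_zero_of_re_ip_self (hV hv) h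

/-- Right multiplication as a linear map in the Clifford number. -/
def rmulₗ (b : X m) : Cl m →ₗ[ℝ] X m where
  toFun c := rmul c b
  map_add' c d := by ext1 x; simp [mul_add]
  map_smul' r c := by ext1 x; simp

/-- The right module spanned by `b_0, …, b_{n-1}`. -/
def rspan (b : ℕ → X m) (n : ℕ) : Submodule ℝ (X m) :=
  LinearMap.range (∑ i : Fin n, (rmulₗ (b i)).comp (LinearMap.proj (R := ℝ) i))

instance (b : ℕ → X m) (n : ℕ) : FiniteDimensional ℝ (rspan b n) := by
  unfold rspan; infer_instance

lemma mem_rspan {b : ℕ → X m} {n : ℕ} {F : X m} :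
    F ∈ rspan b n ↔ ∃ c : ℕ → Cl m, F = ∑ i ∈ Finset.range n, rmul (c i) (b i) := by
  simp only [rspan, LinearMap.mem_range, LinearMap.sum_apply, LinearMap.comp_apply,
    LinearMap.proj_apply]
  constructor
  · rintro ⟨c, rfl⟩
    refine ⟨fun i => if h : i < n then c ⟨i, h⟩ else 0, ?_⟩
    rw [Finset.sum_range]
    exact Finset.sum_congr rfl fun i _ => by simp [rmulₗ]
  · rintro ⟨c, rfl⟩
    refine ⟨fun i => c i, ?_⟩
    rw [Finset.sum_range]; rfl

lemma rmul_mem_rspan {b : ℕ → X m} {n i : ℕ} (hi : i < n) (c : Cl m) :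
    rmul c (b i) ∈ rspan b n := by
  refine mem_rspan.mpr ⟨fun j => if j = i then c else 0, ?_⟩
  rw [Finset.sum_eq_single i]
  · simp
  · intro j _ hj
    ext1 x; simp [hj]
  · intro h; exact absurd (Finset.mem_range.mpr hi) h

lemma self_mem_rspan {b : ℕ → X m} {n i : ℕ} (hi : i < n) : b i ∈ rspan b n := by
  have := rmul_mem_rspan (b := b) hi 1
  have e : rmul 1 (b i) = b i := by ext1 x; simp
  rwa [e] at this

lemma rspan_mono {b : ℕ → X m} {n k : ℕ} (h : n ≤ k) : rspan b n ≤ rspan b k := by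
  intro F hF
  obtain ⟨c, rfl⟩ := mem_rspan.mp hF
  exact Submodule.sum_mem _ fun i hi => rmul_mem_rspan ((Finset.mem_range.mp hi).trans_le h) _

lemma rmul_mem_rspan_of_mem {b : ℕ → X m} {n : ℕ} {F : X m} (hF : F ∈ rspan b n) (c : Cl m) :
    rmul c F ∈ rspan b n := by
  obtain ⟨d, rfl⟩ := mem_rspan.mp hF
  refine mem_rspan.mpr ⟨fun i => d i * c, ?_⟩
  ext1 x
  simp [Finset.sum_mul, ContinuousMap.sum_apply, mul_assoc]

lemma rspan_le_X0 {b : ℕ → X m} {n : ℕ} (hb : ∀ i < n, b i ∈ X0 m) : rspan b n ≤ X0 m := by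
  intro F hF
  obtain ⟨c, rfl⟩ := mem_rspan.mp hF
  exact Submodule.sum_mem _ fun i hi => rmul_mem_X0 (hb i (Finset.mem_range.mp hi)) _

lemma ip_eq_zero_of_mem_rspan {b : ℕ → X m} {n : ℕ} {F G : X m} (h : ∀ i < n, ip F (b i) = 0)
    (hG : G ∈ rspan b n) : ip F G = 0 := by
  obtain ⟨c, rfl⟩ := mem_rspan.mp hG
  rw [map_sum]
  exact Finset.sum_eq_zero fun i hi => by
    rw [ip_rmul_right, h i (Finset.mem_range.mp hi), mul_zero]

/-- `R` is the remainder of the Clifford-orthogonal projection onto the right module spanned by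
`b_0, …, b_{n-1}`. -/
def IsRem (b : ℕ → X m) (n : ℕ) (R : X m →L[ℝ] X m) : Prop :=
  ∀ F, F - R F ∈ rspan b n ∧ ∀ v ∈ rspan b n, ip (R F) v = 0

lemma exists_isRem {b : ℕ → X m} {n : ℕ} (hb : ∀ i < n, b i ∈ X0 m) : ∃ R, IsRem b n R := by
  obtain ⟨P, h1, h2⟩ := exists_orthogonal_projection (rspan b n) (rspan_le_X0 hb)
  refine ⟨ContinuousLinearMap.id ℝ _ - P, fun F => ⟨by simpa using h1 F, fun v hv => ?_⟩⟩
  -- real orthogonality to a right module is Clifford orthogonality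
  refine Cl.eq_zero_of_re_conj_mul fun c => ?_
  rw [← ip_rmul_right]
  exact h2 F _ (rmul_mem_rspan_of_mem hv c)

section IsRem

variable {b : ℕ → X m} {n : ℕ} {R : X m →L[ℝ] X m}

lemma IsRem.eq (hR : IsRem b n R) (hb : ∀ i < n, b i ∈ X0 m) {F G : X m}
    (h1 : F - G ∈ rspan b n) (h2 : ∀ i < n, ip G (b i) = 0) : R F = G := by
  have hmem : R F - G ∈ rspan b n := by
    have := (rspan b n).sub_mem h1 (hR F).1
    rwa [sub_sub_sub_cancel_left] at this
  refine sub_eq_zero.mp (eq_zero_of_re_ip_self (rspan_le_X0 hb hmem) ?_)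
  rw [map_sub ip, sub_apply, (hR F).2 _ hmem, ip_eq_zero_of_mem_rspan h2 hmem]
  simp

lemma IsRem.apply_eq_zero_iff (hR : IsRem b n R) (hb : ∀ i < n, b i ∈ X0 m) {F : X m} :
    R F = 0 ↔ F ∈ rspan b n := by
  constructor
  · intro h
    simpa [h] using (hR F).1
  · intro h
    exact hR.eq hb (by simpa using h) (by simp)

lemma IsRem.mem_X0 (hR : IsRem b n R) (hb : ∀ i < n, b i ∈ X0 m) {F : X m} (hF : F ∈ X0 m) :
    R F ∈ X0 m := by
  have := (X0 m).sub_mem hF (rspan_le_X0 hb (hR F).1)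
  rwa [sub_sub_cancel] at this

end IsRem

section Rep

variable {f g : E m → Cl m} {F G : X m}

lemma Rep.sub (hf : Rep f F) (hg : Rep g G) : Rep (fun x => f x - g x) (F - G) := fun x hx => by
  change f x - g x = F x - G x
  rw [hf x hx, hg x hx]

lemma Rep.smul (hf : Rep f F) (c : ℝ) : Rep (fun x => c • f x) (c • F) := fun x hx => by
  change c • f x = c • F x
  rw [hf x hx]

lemma Rep.rmul (hf : Rep f F) (c : Cl m) : Rep (fun x => f x * c) (rmul c F) := fun x hx => by
  change f x * c = F x * c
  rw [hf x hx]

lemma Rep.sum {ι : Type*} {s : Finset ι} {f : ι → E m → Cl m} {F : ι → X m}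
    (h : ∀ i ∈ s, Rep (f i) (F i)) : Rep (fun x => ∑ i ∈ s, f i x) (∑ i ∈ s, F i) := fun x hx => by
  rw [ContinuousMap.sum_apply]
  exact Finset.sum_congr rfl fun i hi => h i hi x hx

lemma Rep.congr (hf : Rep f F) (h : Set.EqOn g f (B1 m)) : Rep g F := fun x hx =>
  (h (mem_ball_zero_iff.mpr hx)).trans (hf x hx)

lemma Rep.eqOn (hf : Rep f F) (hg : Rep g F) : Set.EqOn f g (B1 m) :=
  (rep_iff.mp hf).trans (rep_iff.mp hg).symm

lemma Rep.unique (hf : Rep f F) (hg : Rep f G) : F = G := by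
  refine sub_eq_zero.mp (eq_zero_of_rep_zero fun x hx => ?_)
  have := rep_iff.mp (hf.sub hg) hx
  rw [← this]; simp

lemma Rep.normalize (hf : Rep f F) : Rep (normalize f) ((hN F)⁻¹ • F) := by
  rw [← hardyNorm_eq_hN hf]
  exact hf.smul _

/-- The projection of the definition exists and is the orthogonal projection. -/
lemma exists_rep_proj {β α : E m → Cl m} {b : X m} (hβ : Rep β b) (hb : b ∈ X0 m)
    (hα : Rep α F) : ∃ c, Rep (proj β α) (CliffordTM.rmul c b) ∧
      ip (F - CliffordTM.rmul c b) b = 0 := by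
  have key : ∀ c, hardyInner (fun x => α x - β x * c) β = ip (F - CliffordTM.rmul c b) b :=
    fun c => hardyInner_eq (hα.sub (hβ.rmul c)) hβ
  have hex : ∃ c : Cl m, hardyInner (fun x => α x - β x * c) β = 0 := by
    obtain ⟨R, hR⟩ := exists_isRem (b := fun _ => b) (n := 1) (fun _ _ => hb)
    obtain ⟨c, hc⟩ := mem_rspan.mp (hR F).1
    refine ⟨c 0, ?_⟩
    rw [key]
    have h2 := (hR F).2 b (self_mem_rspan (b := fun _ => b) (i := 0) one_pos)
    have h3 : R F = F - CliffordTM.rmul (c 0) b := by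
      rw [Finset.sum_range_one] at hc
      rw [← hc]; abel
    rwa [← h3]
  refine ⟨hex.choose, ?_, (key _).symm.trans hex.choose_spec⟩
  rw [proj, dif_pos hex]
  exact hβ.rmul _

/-- For an orthogonal system, the remainder of the definition is the remainder of the projection
onto the whole right module. -/
lemma rep_remainder {B : ℕ → E m → Cl m} {b : ℕ → X m} {n : ℕ} (hB : ∀ i < n, Rep (B i) (b i))
    (hb : ∀ i < n, b i ∈ X0 m) (ho : ∀ i < n, ∀ j < n, i ≠ j → ip (b i) (b j) = 0)
    {R : X m →L[ℝ] X m} (hR : IsRem b n R) {α : E m → Cl m} (hα : Rep α F) :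
    Rep (remainder B n α) (R F) := by
  have h : ∀ i, ∃ c, i < n → Rep (proj (B i) α) (CliffordTM.rmul c (b i)) ∧
      ip (F - CliffordTM.rmul c (b i)) (b i) = 0 := by
    intro i
    by_cases hi : i < n
    · obtain ⟨c, hc⟩ := exists_rep_proj (hB i hi) (hb i hi) hα
      exact ⟨c, fun _ => hc⟩
    · exact ⟨0, fun h => absurd h hi⟩
  choose c hc using h
  have hrep : Rep (remainder B n α) (F - ∑ i ∈ Finset.range n, CliffordTM.rmul (c i) (b i)) :=
    hα.sub (Rep.sum fun i hi => (hc i (Finset.mem_range.mp hi)).1)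
  rw [hR.eq hb (G := F - ∑ i ∈ Finset.range n, CliffordTM.rmul (c i) (b i)) ?_ ?_]
  · exact hrep
  · rw [sub_sub_cancel]; exact mem_rspan.mpr ⟨c, rfl⟩
  · intro j hj
    have h1 := (hc j hj).2
    rw [map_sub ip, sub_apply, sub_eq_zero] at h1
    rw [map_sub ip, sub_apply, sub_eq_zero, h1, map_sum, sum_apply,
      Finset.sum_eq_single j]
    · intro i hi hij
      rw [ip_rmul_left, ho i (Finset.mem_range.mp hi) j hj hij, zero_mul]
    · intro h; exact absurd (Finset.mem_range.mpr hj) h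

lemma inSpan_iff {B : ℕ → E m → Cl m} {b : ℕ → X m} {n : ℕ} (hB : ∀ i < n, Rep (B i) (b i))
    (hf : Rep f F) : InSpan B n f ↔ F ∈ rspan b n := by
  have key : ∀ c : ℕ → Cl m, Rep (fun x => ∑ i ∈ Finset.range n, B i x * c i)
      (∑ i ∈ Finset.range n, CliffordTM.rmul (c i) (b i)) := fun c =>
    Rep.sum fun i hi => (hB i (Finset.mem_range.mp hi)).rmul (c i)
  rw [mem_rspan]
  constructor
  · rintro ⟨c, hc⟩
    exact ⟨c, hf.unique ((key c).congr hc)⟩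
  · rintro ⟨c, rfl⟩
    exact ⟨c, hf.eqOn (key c)⟩

end Rep

/-! ### Monogenic test functions with prescribed zeros -/

/-- There is a unit vector `u ⊥ ω` such that none of the finitely many points `p ≠ a` has the same
projection as `a` to the plane of `ω` and `u`. -/
lemma exists_generic_direction (hm : 1 ≤ m) (a ω : E m) (hω : ‖ω‖ = 1) (S : Finset (E m)) :
    ∃ u : E m, ‖u‖ = 1 ∧ ⟪ω, u⟫ = 0 ∧
      ∀ p ∈ S, p ≠ a → ⟪ω, p⟫ = ⟪ω, a⟫ → ⟪u, p⟫ ≠ ⟪u, a⟫ := by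
  set W : Submodule ℝ (E m) := (Submodule.span ℝ {ω})ᗮ with hW
  have hmem : ∀ x, x ∈ W ↔ ⟪ω, x⟫ = 0 := fun x => Submodule.mem_orthogonal_singleton_iff_inner_right
  have hω0 : ω ≠ 0 := by rintro rfl; simp at hω
  have hfin : Module.finrank ℝ W = m := by
    have : Fact (Module.finrank ℝ (E m) = m + 1) := ⟨by simp⟩
    exact Submodule.finrank_orthogonal_span_singleton hω0
  have hnt : Nontrivial W := Module.nontrivial_of_finrank_pos (R := ℝ) (by omega)
  obtain ⟨e, he⟩ := exists_ne (0 : W)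
  let ι := Option {p : E m // p ∈ S ∧ p ≠ a ∧ ⟪ω, p⟫ = ⟪ω, a⟫}
  have : Finite {p : E m // p ∈ S ∧ p ≠ a ∧ ⟪ω, p⟫ = ⟪ω, a⟫} :=
    (S.finite_toSet.subset fun p hp => hp.1).to_subtype
  let v : ι → W := fun i => i.elim e fun p =>
    ⟨p.1 - a, (hmem _).mpr (by rw [inner_sub_right, p.2.2.2, sub_self])⟩
  obtain ⟨l, hl⟩ := Module.exists_dual_forall_apply_ne_zero (K := ℝ) v (by
    rintro (_ | p)
    · exact he
    · exact fun h => p.2.2.1 (sub_eq_zero.mp (congrArg Subtype.val h)))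
  let u₀ : W := (InnerProductSpace.toDual ℝ W).symm (LinearMap.toContinuousLinearMap l)
  have hu₀ : ∀ x : W, ⟪u₀, x⟫ = l x := fun x => InnerProductSpace.toDual_symm_apply
  have hne : u₀ ≠ 0 := fun h => hl none (by rw [← hu₀, h, inner_zero_left])
  have hpos : 0 < ‖(u₀ : E m)‖ := norm_pos_iff.mpr fun h => hne (Subtype.ext h)
  refine ⟨‖(u₀ : E m)‖⁻¹ • (u₀ : E m), ?_, ?_, ?_⟩
  · rw [norm_smul, norm_inv, norm_norm, inv_mul_cancel₀ hpos.ne']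
  · rw [inner_smul_right, (hmem _).mp u₀.2, mul_zero]
  · intro p hp hpa hpω h
    rw [inner_smul_left, inner_smul_left] at h
    have h1 := mul_left_cancel₀ (by simpa using hpos.ne') h
    refine hl (some ⟨p, hp, hpa, hpω⟩) ?_
    rw [← hu₀]
    change ⟪(u₀ : E m), p - a⟫ = 0
    rw [inner_sub_right, h1, sub_self]

section plane

variable {ω u : E m}

lemma vec_mul_conj_mul (hu : ‖u‖ = 1) (h : ⟪ω, u⟫ = 0) :
    vec u * ((vec ω).conj * vec u) = -vec ω := by
  have h1 := vec_mul_conj_add ω u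
  rw [h, mul_zero, zero_smul, add_eq_zero_iff_eq_neg'] at h1
  rw [← mul_assoc, h1, neg_mul, mul_assoc, conj_vec_mul_self, hu]
  simp

lemma conj_mul_sq (hω : ‖ω‖ = 1) (hu : ‖u‖ = 1) (h : ⟪ω, u⟫ = 0) :
    ((vec ω).conj * vec u) * ((vec ω).conj * vec u) = -1 := by
  rw [mul_assoc, vec_mul_conj_mul hu h, mul_neg, conj_vec_mul_self, hω]
  simp

end plane

/-- The complex coordinate `⟨ω, x⟩ + ⟨u, x⟩ i`. -/
def planeCoord (ω u : E m) : E m →L[ℝ] ℂ :=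
  Complex.ofRealCLM.comp (innerSL ℝ ω) + (innerSL ℝ u).smulRight Complex.I

lemma planeCoord_apply (ω u x : E m) : planeCoord ω u x = ⟪ω, x⟫ + ⟪u, x⟫ * Complex.I := by
  simp [planeCoord]

section poly

open Polynomial

lemma iteratedDeriv_eval_ofReal (Q : ℂ[X]) (k : ℕ) :
    iteratedDeriv k (fun t : ℝ => Q.eval (t : ℂ))
      = fun t : ℝ => (derivative^[k] Q).eval (t : ℂ) := by
  induction k with
  | zero => simp
  | succ k ih =>
    rw [iteratedDeriv_succ, ih]
    ext t
    rw [Function.iterate_succ_apply']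
    exact ((derivative^[k] Q).hasDerivAt (t : ℂ)).comp_ofReal.deriv

lemma contDiff_eval (P : ℂ[X]) {n : WithTop ℕ∞} : ContDiff ℂ n fun z => P.eval z := by
  simpa using P.contDiff_aeval (𝕜 := ℂ) n

/-- The function `x ↦ φ (P (⟨ω, x⟩ + ⟨u, x⟩ i))`, with `φ` an embedding of `ℂ` in the Clifford
algebra. -/
def planeWave (φ : ℂ →ₐ[ℝ] Cl m) (ω u : E m) (P : ℂ[X]) (x : E m) : Cl m :=
  φ (P.eval (planeCoord ω u x))

variable (φ : ℂ →ₐ[ℝ] Cl m) (ω u : E m) (P : ℂ[X])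

lemma dirDeriv_planeWave (k : ℕ) (v p : E m) : dirDeriv k v (planeWave φ ω u P) p =
    φ (k.factorial *
      (P.comp (C (planeCoord ω u p) + C (planeCoord ω u v) * Polynomial.X)).coeff k) := by
  set Q := P.comp (C (planeCoord ω u p) + C (planeCoord ω u v) * Polynomial.X) with hQ
  let L : ℂ →L[ℝ] Cl m := LinearMap.toContinuousLinearMap φ.toLinearMap
  have h1 : (fun t : ℝ => planeWave φ ω u P (p + t • v)) = fun t : ℝ => L (Q.eval (t : ℂ)) := by
    ext1 t
    change φ _ = φ _
    rw [hQ, eval_comp, map_add, map_smul]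
    simp only [Complex.real_smul, eval_add, eval_mul, eval_C, eval_X]
    rw [mul_comm (t : ℂ)]
  have h2 : ContDiffAt ℝ k (fun t : ℝ => Q.eval (t : ℂ)) 0 :=
    (((contDiff_eval Q).restrict_scalars ℝ).comp Complex.ofRealCLM.contDiff).contDiffAt
  rw [dirDeriv, h1, iteratedDeriv_clm_comp L k h2, iteratedDeriv_eval_ofReal]
  change φ _ = φ _
  beta_reduce
  rw [Complex.ofReal_zero, ← coeff_zero_eq_eval_zero, coeff_iterate_derivative]
  simp [Nat.descFactorial_self]

lemma hasFDerivAt_planeWave (x : E m) : HasFDerivAt (planeWave φ ω u P)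
    ((LinearMap.toContinuousLinearMap φ.toLinearMap).comp
      ((P.derivative.eval (planeCoord ω u x) • (1 : ℂ →L[ℝ] ℂ)).comp (planeCoord ω u))) x := by
  have h1 := (P.hasDerivAt (planeCoord ω u x)).complexToReal_fderiv
  exact (LinearMap.toContinuousLinearMap φ.toLinearMap).hasFDerivAt.comp x
    (h1.comp x (planeCoord ω u).hasFDerivAt)

lemma contDiff_planeWave {n : WithTop ℕ∞} : ContDiff ℝ n (planeWave φ ω u P) :=
  (LinearMap.toContinuousLinearMap φ.toLinearMap).contDiff.comp
    (((contDiff_eval P).restrict_scalars ℝ).comp (planeCoord ω u).contDiff)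

variable {φ ω u}

/-- The plane wave is left monogenic if `ω + u φ(i) = 0`. -/
lemma planeWave_monogenic (h : vec ω + vec u * φ Complex.I = 0) (x : E m) :
    ∑ i : Fin (m + 1), eVec i * fderiv ℝ (planeWave φ ω u P) x (EuclideanSpace.single i 1) = 0 := by
  have key : ∀ i : Fin (m + 1),
      eVec i * fderiv ℝ (planeWave φ ω u P) x (EuclideanSpace.single i 1)
      = (ω i • eVec i + (u i • eVec i) * φ Complex.I)
        * φ (P.derivative.eval (planeCoord ω u x)) := by
    intro i
    rw [(hasFDerivAt_planeWave φ ω u P x).fderiv]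
    change eVec i * φ (P.derivative.eval (planeCoord ω u x)
      * planeCoord ω u (EuclideanSpace.single i 1)) = _
    rw [mul_comm, map_mul, ← mul_assoc, planeCoord_apply, map_add, map_mul]
    have hr : ∀ r : ℝ, φ (r : ℂ) = r • (1 : Cl m) := fun r => by
      rw [← Algebra.algebraMap_eq_smul_one]; exact φ.commutes r
    rw [hr, hr]
    simp [EuclideanSpace.inner_single_right, mul_add]
  simp_rw [key]
  rw [← Finset.sum_mul, Finset.sum_add_distrib, ← Finset.sum_mul]
  change (vec ω + vec u * φ Complex.I) * _ = 0
  rw [h, zero_mul]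

/-- A function in the reproducing space that vanishes to order exactly `M` at `a` along `ω`, to
order `M` at `a` along every line, and to order larger than `N` at the other points of `S`. -/
theorem exists_test_function (hm : 1 ≤ m) (a ω : E m) (hω : ‖ω‖ = 1) (S : Finset (E m)) (M N : ℕ) :
    ∃ (f : E m → Cl m) (F : X m), F ∈ X0 m ∧ Rep f F ∧
      (∀ k < M, ∀ v, dirDeriv k v f a = 0) ∧ dirDeriv M ω f a ≠ 0 ∧
      ∀ p ∈ S, p ≠ a → ∀ k ≤ N, ∀ v, dirDeriv k v f p = 0 := by
  classical
  obtain ⟨u, hu, hωu, hgen⟩ := exists_generic_direction hm a ω hω S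
  let φ : ℂ →ₐ[ℝ] Cl m := Complex.lift ⟨(vec ω).conj * vec u, conj_mul_sq hω hu hωu⟩
  have hφI : φ Complex.I = (vec ω).conj * vec u :=
    Complex.liftAux_apply_I _ (conj_mul_sq hω hu hωu)
  have hφ : vec ω + vec u * φ Complex.I = 0 := by rw [hφI, vec_mul_conj_mul hu hωu]; simp
  have hinj : Function.Injective φ := φ.toRingHom.injective
  set ζ := planeCoord ω u with hζ
  have hζω : ζ ω = 1 := by
    rw [hζ, planeCoord_apply, real_inner_self_eq_norm_sq, hω, real_inner_comm, hωu]; simp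
  have hζp : ∀ p ∈ S, p ≠ a → ζ a - ζ p ≠ 0 := by
    intro p hp hpa h0
    rw [sub_eq_zero, hζ, planeCoord_apply, planeCoord_apply, Complex.ext_iff] at h0
    simp at h0
    exact hgen p hp hpa h0.1.symm h0.2.symm
  let P : ℂ[X] := (Polynomial.X - C (ζ a)) ^ M * ∏ p ∈ S.erase a, (Polynomial.X - C (ζ p)) ^ (N + 1)
  have hc := (contDiff_planeWave φ ω u P (n := 1))
  refine ⟨planeWave φ ω u P, restr _ hc.continuous.continuousOn,
    restr_mem_X0 one_lt_two hc.contDiffOn (fun x _ => planeWave_monogenic P hφ x) _,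
    fun x _ => rfl, ?_, ?_, ?_⟩
  · intro k hk v
    rw [dirDeriv_planeWave, ← hζ]
    have : Polynomial.X ^ M ∣ P.comp (C (ζ a) + C (ζ v) * Polynomial.X) := by
      simp only [P, mul_comp, pow_comp, sub_comp, X_comp, C_comp, add_sub_cancel_left, mul_pow]
      exact Dvd.dvd.mul_right (Dvd.intro_left _ rfl) _
    rw [X_pow_dvd_iff.mp this k hk]
    simp
  · rw [dirDeriv_planeWave, ← hζ]
    have : P.comp (C (ζ a) + C (ζ ω) * Polynomial.X)
        = (∏ p ∈ S.erase a, (Polynomial.X - C (ζ p)) ^ (N + 1)).comp (C (ζ a) + Polynomial.X)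
          * Polynomial.X ^ M := by
      simp only [P, mul_comp, pow_comp, sub_comp, X_comp, C_comp, hζω, map_one, one_mul,
        add_sub_cancel_left]
      ring
    rw [this, coeff_mul_X_pow', if_pos le_rfl, Nat.sub_self, coeff_zero_eq_eval_zero, eval_comp]
    simp only [eval_add, eval_C, eval_X, add_zero, eval_prod, eval_pow, eval_sub]
    rw [Ne, map_eq_zero_iff φ hinj]
    refine mul_ne_zero (by exact_mod_cast M.factorial_ne_zero) (Finset.prod_ne_zero_iff.mpr ?_)
    intro p hp
    exact pow_ne_zero _ (hζp p (Finset.mem_of_mem_erase hp) (Finset.ne_of_mem_erase hp))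
  · intro p hp hpa k hk v
    rw [dirDeriv_planeWave, ← hζ]
    have : Polynomial.X ^ (N + 1) ∣ P.comp (C (ζ p) + C (ζ v) * Polynomial.X) := by
      have h1 : (Polynomial.X - C (ζ p)) ^ (N + 1) ∣ P := Dvd.dvd.mul_left
        (Finset.dvd_prod_of_mem _ (Finset.mem_erase.mpr ⟨hpa, hp⟩)) _
      obtain ⟨Q, hQ⟩ := h1
      rw [hQ]
      simp only [mul_comp, pow_comp, sub_comp, X_comp, C_comp, add_sub_cancel_left, mul_pow]
      exact Dvd.dvd.mul_right (Dvd.intro_left _ rfl) _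
    rw [X_pow_dvd_iff.mp this k (Nat.lt_succ_of_le hk)]
    simp

end poly

/-! ### Convergence of normalized remainders -/

/-- A curve divided by the first nonvanishing power of its parameter. -/
lemma tendsto_inv_pow_smul {Y : Type*} [NormedAddCommGroup Y] [NormedSpace ℝ Y] {γ : ℝ → Y} {n : ℕ}
    (hγ : ContDiffAt ℝ n γ 0) (h : ∀ k < n, iteratedDeriv k γ 0 = 0) :
    Tendsto (fun t : ℝ => (t ^ n)⁻¹ • γ t) (𝓝[>] 0)
      (𝓝 ((n.factorial : ℝ)⁻¹ • iteratedDeriv n γ 0)) := by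
  obtain ⟨u, hu, hγu⟩ := hγ.contDiffOn le_rfl (by simp)
  obtain ⟨δ, hδ, hsub⟩ := Metric.mem_nhds_iff.mp hu
  have hγs : ContDiffOn ℝ n γ (Metric.ball (0 : ℝ) δ) := hγu.mono fun x hx => hsub hx
  have hT := taylor_tendsto (convex_ball (0 : ℝ) δ) (Metric.mem_ball_self hδ) hγs
  have hev : ∀ t : ℝ, taylorWithinEval γ n (Metric.ball (0 : ℝ) δ) 0 t
      = t ^ n • ((n.factorial : ℝ)⁻¹ • iteratedDeriv n γ 0) := by
    intro t
    rw [taylor_within_apply, Finset.sum_eq_single n]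
    · rw [iteratedDerivWithin_of_isOpen Metric.isOpen_ball (Metric.mem_ball_self hδ), smul_smul,
        sub_zero, mul_comm]
    · intro k hk hkn
      rw [iteratedDerivWithin_of_isOpen Metric.isOpen_ball (Metric.mem_ball_self hδ),
        h k (by have := Finset.mem_range.mp hk; omega), smul_zero]
    · simp
  rw [Metric.isOpen_ball.nhdsWithin_eq (Metric.mem_ball_self hδ)] at hT
  have hT2 := (hT.mono_left (nhdsWithin_le_nhds (s := Set.Ioi (0 : ℝ)))).add_const
    ((n.factorial : ℝ)⁻¹ • iteratedDeriv n γ 0)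
  rw [zero_add] at hT2
  refine hT2.congr' ?_
  filter_upwards [self_mem_nhdsWithin] with t ht
  have ht' : (t : ℝ) ^ n ≠ 0 := pow_ne_zero _ (ne_of_gt ht)
  rw [hev, sub_zero, smul_sub, smul_smul (t ^ n)⁻¹, inv_mul_cancel₀ ht', one_smul, sub_add_cancel]

lemma normalized_smul {c : ℝ} (hc : 0 < c) (F : X m) :
    (hN (c • F))⁻¹ • (c • F) = (hN F)⁻¹ • F := by
  rw [hN_smul, abs_of_pos hc, smul_smul]
  congr 1
  field_simp

lemma tendsto_normalized {l : Filter ℝ} {G : ℝ → X m} {F : X m} (hG : Tendsto G l (𝓝 F))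
    (hF : F ≠ 0) : Tendsto (fun t => (hN (G t))⁻¹ • G t) l (𝓝 ((hN F)⁻¹ • F)) :=
  (((continuous_hN.tendsto F).comp hG).inv₀ fun h => hF (eq_zero_of_hN h)).smul hG

lemma tendsto_hardyNorm_sub {l : Filter ℝ} {g : ℝ → E m → Cl m} {G : ℝ → X m} {f : E m → Cl m}
    {F : X m} (hg : ∀ᶠ t in l, Rep (g t) (G t)) (hG : Tendsto G l (𝓝 F)) (hf : Rep f F) :
    Tendsto (fun t => hardyNorm (fun x => g t x - f x)) l (𝓝 0) := by
  have h1 : Tendsto (fun t => ‖G t - F‖) l (𝓝 0) := tendsto_iff_norm_sub_tendsto_zero.mp hG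
  refine squeeze_zero' (Eventually.of_forall fun t => hardyNorm_nonneg _) ?_ h1
  filter_upwards [hg] with t ht
  rw [hardyNorm_eq_hN (ht.sub hf)]
  exact hN_le_norm _

lemma sphereMean_neg (f : E m → Cl m) (r : ℝ) : sphereMean (fun x => -f x) r = sphereMean f r := by
  simp [sphereMean]

/-- Limits in the Hardy norm are unique. -/
lemma rep_of_tendsto_hardyNorm {l : Filter ℝ} [l.NeBot] {g : ℝ → E m → Cl m} {G : ℝ → X m}
    {f : E m → Cl m} {F : X m} (hg : ∀ᶠ t in l, Rep (g t) (G t)) (hG : Tendsto G l (𝓝 F))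
    (hf : MemHardy f) (h : Tendsto (fun t => hardyNorm (fun x => g t x - f x)) l (𝓝 0)) :
    Rep f F := by
  have hfc : ContinuousOn f (B1 m) := hf.1.1.continuousOn
  have hnfc : ContinuousOn (fun x => -f x) (B1 m) := hfc.neg
  have hFc := continuousOn_of_rep (rep_ext F)
  have h1 : Tendsto (fun t => ‖F - G t‖) l (𝓝 0) := by
    simpa [norm_sub_rev] using tendsto_iff_norm_sub_tendsto_zero.mp hG
  have hzero : Set.EqOn (fun x => ext F x + -f x) 0 (B1 m) := by
    refine eqOn_zero_of_sphereMean (hFc.add hnfc) fun r hr => ?_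
    refine le_antisymm ?_ (sphereMean_nonneg _ _)
    have h2 := h1.add h
    rw [add_zero] at h2
    refine ge_of_tendsto h2 ?_
    filter_upwards [hg] with t ht
    have htc := continuousOn_of_rep ht
    have hgf : ContinuousOn (fun x => g t x + -f x) (B1 m) := htc.add hnfc
    have e1 : (fun x => ext F x + -f x) = fun x => (ext F x - g t x) + (g t x + -f x) := by
      ext1 x; abel
    rw [e1]
    have hb : BddAbove (sphereMean (fun x => g t x - f x) '' Set.Ioo 0 1) := by
      refine ⟨‖G t‖ + hardyNorm f, ?_⟩
      rintro _ ⟨s, hs, rfl⟩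
      simp_rw [sub_eq_add_neg]
      refine (sphereMean_add_le htc hnfc hs).trans ?_
      rw [sphereMean_neg]
      exact add_le_add (sphereMean_le ht hs) (sphereMean_le_hardyNorm hf.2 hs)
    refine (sphereMean_add_le (hFc.sub htc) hgf hr).trans
      (add_le_add (sphereMean_le ((rep_ext F).sub ht) hr) ?_)
    simp_rw [← sub_eq_add_neg]
    exact sphereMean_le_hardyNorm hb hr
  refine (rep_ext F).congr fun x hx => ?_
  have := hzero hx
  simp only [Pi.zero_apply, add_neg_eq_zero] at this
  exact this.symm

/-! ### The Takenaka–Malmquist recursion -/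

/-- The state of the recursion at the index `i`: on the ball `B_i` is the restriction of the
continuous function `b_i`, a nonzero multiple of the remainder of the first derivative kernel
`∂_{ω_i}^{κ_i} S_y |_{y = a_i}` outside the right module spanned by the earlier functions. -/
structure Adapted (a ω : ℕ → E m) (B : ℕ → E m → Cl m) (b : ℕ → X m) (κ : ℕ → ℕ) (i : ℕ) :
    Prop where
  rep : Rep (B i) (b i)
  mem : b i ∈ X0 m
  lower : ∀ k < κ i, szegoDerivX k (ω i) (a i) ∈ rspan b i
  notMem : szegoDerivX (κ i) (ω i) (a i) ∉ rspan b i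
  remainder : ∃ s : ℝ, s ≠ 0 ∧ szegoDerivX (κ i) (ω i) (a i) - s • b i ∈ rspan b i
  orth : ∀ v ∈ rspan b i, ip (b i) v = 0

section Adapted

variable {a ω : ℕ → E m} {B : ℕ → E m → Cl m} {b : ℕ → X m} {κ : ℕ → ℕ} {n : ℕ}

lemma Adapted.ip_eq_zero (h : ∀ i < n, Adapted a ω B b κ i) :
    ∀ i < n, ∀ j < n, i ≠ j → ip (b i) (b j) = 0 := by
  intro i hi j hj hij
  rcases lt_or_gt_of_ne hij with hlt | hlt
  · rw [← conj_ip, (h j hj).orth _ (self_mem_rspan hlt), Cl.conj_zero]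
  · exact (h i hi).orth _ (self_mem_rspan hlt)

lemma Adapted.kernel_mem {i : ℕ} (h : Adapted a ω B b κ i) {k : ℕ} (hk : k ≤ κ i) :
    szegoDerivX k (ω i) (a i) ∈ rspan b (i + 1) := by
  rcases hk.lt_or_eq with hk | rfl
  · exact rspan_mono i.le_succ (h.lower k hk)
  · obtain ⟨s, -, hs⟩ := h.remainder
    have := (rspan b (i + 1)).add_mem (rspan_mono i.le_succ hs)
      ((rspan b (i + 1)).smul_mem s (self_mem_rspan i.lt_succ_self))
    rwa [sub_add_cancel] at this

/-- A function orthogonal to the kernels of the first `n` parameters is orthogonal to the right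
module that they generate. -/
lemma Adapted.ip_rspan_eq_zero (h : ∀ i < n, Adapted a ω B b κ i) {F : X m}
    (hF : ∀ i < n, ip F (szegoDerivX (κ i) (ω i) (a i)) = 0) : ∀ v ∈ rspan b n, ip F v = 0 := by
  have key : ∀ i, i < n → ip F (b i) = 0 := by
    intro i
    induction i using Nat.strong_induction_on with
    | _ i ih =>
      intro hi
      obtain ⟨s, hs0, hs⟩ := (h i hi).remainder
      have h1 : ip F (szegoDerivX (κ i) (ω i) (a i) - s • b i) = 0 :=
        ip_eq_zero_of_mem_rspan (fun j hj => ih j hj (hj.trans hi)) hs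
      rw [map_sub, hF i hi, map_smul, zero_sub, neg_eq_zero, smul_eq_zero] at h1
      exact h1.resolve_left hs0
  exact fun v hv => ip_eq_zero_of_mem_rspan key hv

/-- A derivative kernel at `a_n` of an order that exceeds the orders used at earlier parameters
equal to `a_n` lies outside the right module spanned so far. -/
lemma Adapted.szegoDerivX_notMem (hm : 1 ≤ m) (ha : ∀ n, ‖a n‖ < 1) (hω : ∀ n, ‖ω n‖ = 1)
    (h : ∀ i < n, Adapted a ω B b κ i) {M : ℕ} (hM : ∀ i < n, a i = a n → κ i < M) :
    szegoDerivX M (ω n) (a n) ∉ rspan b n := by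
  classical
  obtain ⟨f, F, hF, hf, h1, h2, h3⟩ := exists_test_function hm (a n) (ω n) (hω n)
    ((Finset.range n).image a) M ((Finset.range n).sup κ)
  intro hmem
  refine h2 ?_
  rw [dirDeriv_eq_ip hF hf (ha n)]
  refine Adapted.ip_rspan_eq_zero h (fun i hi => ?_) _ hmem
  rw [← dirDeriv_eq_ip hF hf (ha i)]
  by_cases hin : a i = a n
  · rw [hin]; exact h1 _ (hM i hi hin) _
  · exact h3 _ (Finset.mem_image_of_mem a (Finset.mem_range.mpr hi)) hin _
      (Finset.le_sup (f := κ) (Finset.mem_range.mpr hi)) _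

end Adapted

/-- What the recursion determines at the index `n`: the order `k`, the function `F` and the
convergence of the normalized remainders of `S_y` to `F` as `y → a_n` in the direction `ω_n`. -/
structure IsStep (a ω : ℕ → E m) (B : ℕ → E m → Cl m) (b : ℕ → X m) (n : ℕ) (F : X m) (k : ℕ) :
    Prop where
  mem : F ∈ X0 m
  lower : ∀ j < k, szegoDerivX j (ω n) (a n) ∈ rspan b n
  notMem : szegoDerivX k (ω n) (a n) ∉ rspan b n
  remainder : ∃ s : ℝ, s ≠ 0 ∧ szegoDerivX k (ω n) (a n) - s • F ∈ rspan b n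
  orth : ∀ v ∈ rspan b n, ip F v = 0
  rep : Rep (normalize (CliffordTM.remainder B n (szegoDeriv k (ω n) (a n)))) F
  fresh : (∀ j < n, a j ≠ a n) → k = 0
  limit : ∃ G : ℝ → X m, Tendsto G (𝓝[>] 0) (𝓝 F) ∧ ∀ᶠ ρ : ℝ in 𝓝[>] 0,
    Rep (normalize (CliffordTM.remainder B n (szego (a n + ρ • ω n)))) (G ρ)

section recursion

variable {a ω : ℕ → E m} {B : ℕ → E m → Cl m} {b : ℕ → X m} {κ : ℕ → ℕ} {n : ℕ}

theorem exists_isStep (hm : 1 ≤ m) (ha : ∀ n, ‖a n‖ < 1) (hω : ∀ n, ‖ω n‖ = 1)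
    (h : ∀ i < n, Adapted a ω B b κ i) : ∃ F k, IsStep a ω B b n F k := by
  classical
  have hB : ∀ i < n, Rep (B i) (b i) := fun i hi => (h i hi).rep
  have hb : ∀ i < n, b i ∈ X0 m := fun i hi => (h i hi).mem
  have ho := Adapted.ip_eq_zero h
  obtain ⟨R, hR⟩ := exists_isRem hb
  have hex : ∃ k, szegoDerivX k (ω n) (a n) ∉ rspan b n :=
    ⟨(Finset.range n).sup κ + 1, Adapted.szegoDerivX_notMem hm ha hω h fun i hi _ =>
      Nat.lt_succ_of_le (Finset.le_sup (f := κ) (Finset.mem_range.mpr hi))⟩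
  set k := Nat.find hex with hk
  have hk1 : szegoDerivX k (ω n) (a n) ∉ rspan b n := Nat.find_spec hex
  have hk2 : ∀ j < k, szegoDerivX j (ω n) (a n) ∈ rspan b n := fun j hj =>
    not_not.mp (Nat.find_min hex hj)
  set T := R (szegoDerivX k (ω n) (a n)) with hT
  have hT0 : T ≠ 0 := fun h0 => hk1 ((hR.apply_eq_zero_iff hb).mp h0)
  have hc : hN T ≠ 0 := fun h0 => hT0 (eq_zero_of_hN h0)
  refine ⟨(hN T)⁻¹ • T, k, ?_, hk2, hk1, ⟨hN T, hc, ?_⟩, ?_, ?_, ?_, ?_⟩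
  · exact (X0 m).smul_mem _ (hR.mem_X0 hb (szegoDerivX_mem_X0 (ha n) _ _))
  · rw [smul_smul, mul_inv_cancel₀ hc, one_smul]
    exact (hR _).1
  · intro v hv
    rw [map_smul, smul_apply, (hR _).2 v hv, smul_zero]
  · exact (rep_remainder hB hb ho hR (rep_szegoDeriv (ha n) k (ω n))).normalize
  · intro hfresh
    have h0 : szegoDerivX 0 (ω n) (a n) ∉ rspan b n :=
      Adapted.szegoDerivX_notMem hm ha hω h fun i hi hin => absurd hin (hfresh i hi)
    exact (Nat.find_eq_zero hex).mpr h0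
  · refine ⟨fun ρ => (hN (R (szegoX (a n + ρ • ω n))))⁻¹ • R (szegoX (a n + ρ • ω n)), ?_, ?_⟩
    · -- the first nonvanishing Taylor coefficient of the remainders is that of order `k`
      have hγ := contDiffAt_szegoX_line (n := k) (ha n) (ω n)
      have hRγ : ContDiffAt ℝ k (fun t : ℝ => R (szegoX (a n + t • ω n))) 0 :=
        R.contDiff.contDiffAt.comp (0 : ℝ) hγ
      have hder : ∀ j ≤ k, iteratedDeriv j (fun t : ℝ => R (szegoX (a n + t • ω n))) 0
          = R (szegoDerivX j (ω n) (a n)) := fun j _ =>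
        iteratedDeriv_clm_comp R j (contDiffAt_szegoX_line (ha n) (ω n))
      have hlim := tendsto_inv_pow_smul hRγ fun j hj => by
        rw [hder j hj.le]; exact (hR.apply_eq_zero_iff hb).mpr (hk2 j hj)
      rw [hder k le_rfl, ← hT] at hlim
      have hfac : (0 : ℝ) < (k.factorial : ℝ)⁻¹ := by positivity
      have hlim2 := tendsto_normalized hlim (smul_ne_zero hfac.ne' hT0)
      rw [normalized_smul hfac] at hlim2
      refine hlim2.congr' ?_
      filter_upwards [self_mem_nhdsWithin] with t ht
      exact normalized_smul (inv_pos.mpr (pow_pos ht k)) _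
    · filter_upwards [nhdsWithin_le_nhds (eventually_norm_lt (ha n) (ω n))] with ρ hρ
      exact (rep_remainder hB hb ho hR (rep_szego hρ)).normalize

/-- If each `B_n` agrees with the function that the recursion determines from its predecessors, then
the recursion runs through all indices. -/
theorem exists_adapted (hm : 1 ≤ m) (ha : ∀ n, ‖a n‖ < 1) (hω : ∀ n, ‖ω n‖ = 1)
    (hB : ∀ (n : ℕ) (b : ℕ → X m) (κ : ℕ → ℕ), (∀ i < n, Adapted a ω B b κ i) →
      ∀ F k, IsStep a ω B b n F k → Rep (B n) F) :
    ∃ (b : ℕ → X m) (κ : ℕ → ℕ), ∀ n, Adapted a ω B b κ n ∧ IsStep a ω B b n (b n) (κ n) := by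
  classical
  let b : ℕ → X m := fun n => if h : ∃ F, Rep (B n) F then h.choose else 0
  let κ : ℕ → ℕ := fun n => sInf {k | szegoDerivX k (ω n) (a n) ∉ rspan b n}
  refine ⟨b, κ, fun n => ?_⟩
  induction n using Nat.strong_induction_on with
  | _ n ih =>
    have hn := fun i hi => (ih i hi).1
    obtain ⟨F, k, hs⟩ := exists_isStep hm ha hω hn
    have hrep := hB n b κ hn F k hs
    have hbn : b n = F := by
      have hex : ∃ F, Rep (B n) F := ⟨F, hrep⟩
      have : b n = hex.choose := dif_pos hex
      rw [this]
      exact hex.choose_spec.unique hrep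
    have hκn : κ n = k := by
      have hl : IsLeast {k | szegoDerivX k (ω n) (a n) ∉ rspan b n} k :=
        ⟨hs.notMem, fun j hj => not_lt.mp fun hlt => hj (hs.lower j hlt)⟩
      exact hl.csInf_eq
    rw [← hbn, ← hκn] at hs
    exact ⟨⟨hbn ▸ hrep, hs.mem, hs.lower, hs.notMem, hs.remainder, hs.orth⟩, hs⟩

theorem IsTMSystem.exists_adapted (hm : 1 ≤ m) (ha : ∀ n, ‖a n‖ < 1) (hω : ∀ n, ‖ω n‖ = 1)
    (hB : IsTMSystem a ω B) :
    ∃ (b : ℕ → X m) (κ : ℕ → ℕ), ∀ n, Adapted a ω B b κ n ∧ IsStep a ω B b n (b n) (κ n) := by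
  refine CliffordTM.exists_adapted hm ha hω fun n b κ _ F k hs => ?_
  by_cases hfresh : ∀ j < n, a j ≠ a n
  · have h1 := hs.rep
    rw [hs.fresh hfresh, szegoDeriv_zero] at h1
    exact h1.congr (hB.fresh n hfresh)
  · push Not at hfresh
    obtain ⟨G, hG1, hG2⟩ := hs.limit
    exact rep_of_tendsto_hardyNorm hG2 hG1 (hB.memHardy n) (hB.repeated n hfresh)

/-- The Takenaka–Malmquist system in closed recursive form: the normalized remainder of the first
derivative kernel outside the right span of the earlier functions. -/
def tmSystem (a ω : ℕ → E m) (n : ℕ) : E m → Cl m :=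
  let B : ℕ → E m → Cl m := fun i => if _h : i < n then tmSystem a ω i else 0
  normalize (remainder B n
    (szegoDeriv (sInf {k | ¬ InSpan B n (szegoDeriv k (ω n) (a n))}) (ω n) (a n)))
termination_by n

lemma tmSystem_eq (a ω : ℕ → E m) (n : ℕ) : tmSystem a ω n =
    normalize (remainder (tmSystem a ω) n (szegoDeriv
      (sInf {k | ¬ InSpan (tmSystem a ω) n (szegoDeriv k (ω n) (a n))}) (ω n) (a n))) := by
  have h1 : ∀ α, remainder (fun i => if _h : i < n then tmSystem a ω i else 0) n α
      = remainder (tmSystem a ω) n α := by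
    intro α
    ext1 x
    simp only [remainder]
    congr 1
    refine Finset.sum_congr rfl fun i hi => ?_
    simp [Finset.mem_range.mp hi]
  have h2 : ∀ f, InSpan (fun i => if _h : i < n then tmSystem a ω i else 0) n f
      ↔ InSpan (tmSystem a ω) n f := by
    intro f
    simp only [InSpan]
    refine exists_congr fun c => forall₂_congr fun x _ => ?_
    rw [Finset.sum_congr rfl fun i hi => ?_]
    simp [Finset.mem_range.mp hi]
  conv_lhs => rw [tmSystem]
  simp only [h1, h2]

theorem isTMSystem_tmSystem (hm : 1 ≤ m) (ha : ∀ n, ‖a n‖ < 1) (hω : ∀ n, ‖ω n‖ = 1) :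
    IsTMSystem a ω (tmSystem a ω) := by
  obtain ⟨b, κ, h⟩ := exists_adapted (B := tmSystem a ω) hm ha hω (fun n b κ hn F k hs => by
    have hk : sInf {k | ¬ InSpan (tmSystem a ω) n (szegoDeriv k (ω n) (a n))} = k := by
      have hl : IsLeast {k | ¬ InSpan (tmSystem a ω) n (szegoDeriv k (ω n) (a n))} k := by
        simp only [inSpan_iff (fun i hi => (hn i hi).rep) (rep_szegoDeriv (ha n) _ (ω n))]
        exact ⟨hs.notMem, fun j hj => not_lt.mp fun hlt => hj (hs.lower j hlt)⟩
      exact hl.csInf_eq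
    rw [tmSystem_eq, hk]
    exact hs.rep)
  refine ⟨fun n => memHardy_of_rep (h n).1.mem (h n).1.rep, fun n hfresh => ?_, fun n _ => ?_⟩
  · have h1 := (h n).2.rep
    rw [(h n).2.fresh hfresh, szegoDeriv_zero] at h1
    exact (h n).1.rep.eqOn h1
  · obtain ⟨G, hG1, hG2⟩ := (h n).2.limit
    exact tendsto_hardyNorm_sub hG2 hG1 (h n).1.rep

/-! ### Zeros and multiplicities -/

lemma mult_eq_count (a : ℕ → E m) (n : ℕ) [DecidablePred fun j => a j = a n] :
    mult a n = Nat.count (fun j => a j = a n) n + 1 := by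
  have h : {j : ℕ | j ≤ n ∧ a j = a n} = ((Finset.range (n + 1)).filter fun j => a j = a n) := by
    ext j; simp
  rw [mult, h, Set.ncard_coe_finset, ← Nat.count_eq_card_filter_range, Nat.count_succ]
  simp

/-- With one direction for all occurrences of a parameter, the orders are `0, 1, 2, …`. -/
theorem Adapted.kappa_add_one (hm : 1 ≤ m) (ha : ∀ n, ‖a n‖ < 1) (hω : ∀ n, ‖ω n‖ = 1)
    (hab : ∀ n, Adapted a ω B b κ n) (j : ℕ) (hj : ∀ i < j, a i = a j → ω i = ω j) :
    κ j + 1 = mult a j := by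
  classical
  induction j using Nat.strong_induction_on with
  | _ j ih =>
    set p : ℕ → Prop := fun i => a i = a j with hp
    have hprev : ∀ i < j, p i → κ i = Nat.count p i := by
      intro i hi hpi
      have h1 := ih i hi fun l hl hli => by
        rw [hj l (hl.trans hi) (hli.trans hpi), hj i hi hpi]
      rw [mult_eq_count] at h1
      have h2 : (fun l => a l = a i) = p := by
        ext l; simp only [hp]; rw [show a i = a j from hpi]
      simp only [h2] at h1
      omega
    rw [mult_eq_count]
    congr 1
    refine le_antisymm ?_ ?_
    · -- the kernel of order `count p j` is outside the span
      by_contra hlt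
      rw [not_le] at hlt
      refine Adapted.szegoDerivX_notMem hm ha hω (fun i _ => hab i) (M := Nat.count p j)
        (fun i hi hpi => ?_) ((hab j).lower _ hlt)
      rw [hprev i hi hpi]
      exact Nat.count_strict_mono hpi hi
    · -- the kernels of smaller orders come from the earlier occurrences
      by_contra hlt
      rw [not_le] at hlt
      have hi1 : Nat.nth p (κ j) < j := Nat.nth_lt_of_lt_count hlt
      have hi2 : p (Nat.nth p (κ j)) := by
        refine Nat.nth_mem (κ j) fun hf => hlt.trans_le ?_
        rw [Nat.count_eq_card_filter_range]
        exact Finset.card_le_card fun x hx => by simpa using (Finset.mem_filter.mp hx).2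
      have hi3 : Nat.count p (Nat.nth p (κ j)) = κ j := by
        refine Nat.count_nth fun hf => hlt.trans_le ?_
        rw [Nat.count_eq_card_filter_range]
        exact Finset.card_le_card fun x hx => by simpa using (Finset.mem_filter.mp hx).2
      set i := Nat.nth p (κ j)
      have hκ : κ i = κ j := (hprev i hi1 hi2).trans hi3
      have hmem := rspan_mono (Nat.succ_le_of_lt hi1) ((hab i).kernel_mem le_rfl)
      rw [hκ, hj i hi1 hi2, show a i = a j from hi2] at hmem
      exact (hab j).notMem hmem

/-- The zero of `B_n` at an earlier parameter. -/
theorem Adapted.vanishesAlong (ha : ∀ n, ‖a n‖ < 1) (hab : ∀ n, Adapted a ω B b κ n) {j n : ℕ}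
    (hjn : j < n) : VanishesAlong (B n) (a j) (ω j) (κ j + 1) := by
  intro k hk
  rw [dirDeriv_eq_ip (hab n).mem (hab n).rep (ha j)]
  exact (hab n).orth _ (rspan_mono (Nat.succ_le_of_lt hjn)
    ((hab j).kernel_mem (Nat.lt_succ_iff.mp hk)))

/-- The order of vanishing of `B_n` at its own parameter. -/
theorem Adapted.dirDeriv_self (ha : ∀ n, ‖a n‖ < 1) (h : Adapted a ω B b κ n) :
    VanishesAlong (B n) (a n) (ω n) (κ n) ∧ dirDeriv (κ n) (ω n) (B n) (a n) ≠ 0 := by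
  refine ⟨fun k hk => ?_, ?_⟩
  · rw [dirDeriv_eq_ip h.mem h.rep (ha n)]
    exact h.orth _ (h.lower k hk)
  · rw [dirDeriv_eq_ip h.mem h.rep (ha n)]
    obtain ⟨s, hs0, hs⟩ := h.remainder
    have h1 := h.orth _ hs
    rw [map_sub, map_smul, sub_eq_zero] at h1
    rw [h1]
    refine smul_ne_zero hs0 fun h2 => h.notMem ?_
    have h3 : b n = 0 := eq_zero_of_re_ip_self h.mem (by rw [h2, map_zero])
    rwa [h3, smul_zero, sub_zero] at hs

end recursion

end

end CliffordTM

theorem proposition4p1 (m : ℕ) (hm : 1 ≤ m)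
    (a ω : ℕ → CliffordTM.E m) (ha : ∀ n, ‖a n‖ < 1) (hω : ∀ n, ‖ω n‖ = 1) :
    (∃ B : ℕ → CliffordTM.E m → CliffordTM.Cl m, CliffordTM.IsTMSystem a ω B) ∧
    ∀ B : ℕ → CliffordTM.E m → CliffordTM.Cl m, CliffordTM.IsTMSystem a ω B →
      -- `κ j` is the order of the derivative Szegő kernel that the parameter `a j` contributes
      ∃ κ : ℕ → ℕ,
        (∀ j, IsLeast {k : ℕ | ¬ CliffordTM.InSpan B j
            (CliffordTM.szegoDeriv k (ω j) (a j))} (κ j)) ∧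
        (∀ j, Set.EqOn (B j)
            (CliffordTM.normalize (CliffordTM.remainder B j
              (CliffordTM.szegoDeriv (κ j) (ω j) (a j)))) (CliffordTM.B1 m)) ∧
        -- the zero at an earlier parameter, with its multiplicity
        (∀ n, ∀ i < n, B n (a i) = 0 ∧
          (∀ j ≤ i, a j = a i → CliffordTM.VanishesAlong (B n) (a i) (ω j) (κ j + 1)) ∧
          ((∀ j < i, a j = a i → ω j = ω i) →
            CliffordTM.VanishesAlong (B n) (a i) (ω i) (CliffordTM.mult a i))) ∧
        -- the order of vanishing of `B n` at its own last parameter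
        (∀ n, CliffordTM.VanishesAlong (B n) (a n) (ω n) (κ n) ∧
          CliffordTM.dirDeriv (κ n) (ω n) (B n) (a n) ≠ 0) ∧
        (∀ j, (∀ i < j, a i = a j → ω i = ω j) → κ j + 1 = CliffordTM.mult a j) := by
  refine ⟨⟨_, CliffordTM.isTMSystem_tmSystem hm ha hω⟩, fun B hB => ?_⟩
  obtain ⟨b, κ, h⟩ := hB.exists_adapted hm ha hω
  have hab := fun n => (h n).1
  refine ⟨κ, fun j => ?_, fun j => (hab j).rep.eqOn (h j).2.rep, fun n i hi => ⟨?_, ?_, ?_⟩,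
    fun n => (hab n).dirDeriv_self ha, fun j hj => ?_⟩
  · simp only [CliffordTM.inSpan_iff (fun i _ => (hab i).rep)
      (CliffordTM.rep_szegoDeriv (ha j) _ (ω j))]
    exact ⟨(hab j).notMem, fun k hk => not_lt.mp fun hlt => hk ((hab j).lower k hlt)⟩
  · have := CliffordTM.Adapted.vanishesAlong ha hab hi 0 (Nat.succ_pos _)
    simpa [CliffordTM.dirDeriv] using this
  · intro j hj hji
    rw [← hji]
    exact CliffordTM.Adapted.vanishesAlong ha hab (hj.trans_lt hi)
  · intro hdir
    rw [← CliffordTM.Adapted.kappa_add_one hm ha hω hab i hdir]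
    exact CliffordTM.Adapted.vanishesAlong ha hab hi
  · exact CliffordTM.Adapted.kappa_add_one hm ha hω hab j hj
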